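/- Let $L$ be the first-order language (with equality) of Boolean algebras, with symbols $0,1,\cap,\cup,\neg$, enriched by unary predicates $C_n$ for all integers $n\ge 1$. A Boolean algebra is regarded as an $L$-structure by interpreting $C_n(x)$ as "there are at least $n$ distinct atoms $\alpha$ with $\alpha\le x$". Let $T$ be the theory of infinite atomic Boolean algebras in $L$, that is, the set of all $L$-sentences true in every infinite atomic Boolean algebra. Then: 1. $T$ is complete: it is satisfiable, and for every $L$-sentence $\varphi$, either $\varphi$ or $\neg\varphi$ follows from $T$. 2. $T$ is decidable: the set of Gödel numbers of the $L$-sentences that follow from $T$ is computable. 3. $T$ has quantifier elimination: every $L$-formula is equivalent modulo $T$ to a quantifier-free $L$-formula in the same free variables. 4. $T$ is axiomatized by the axioms of Boolean algebras, the sentences "there are at least $n$ elements" for all $n$, the sentence "every nonzero element has an atom below it", and for each $n\ge1$ the sentence stating the intended meaning of $C_n$ ("$C_n(x)$ holds if and only if there are $n$ distinct atoms below $x$"): the consequences of these axioms are exactly the consequences of $T$, and the models of these axioms are exactly the infinite atomic Boolean algebras with $C_n$ interpreted as above. -/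

import Mathlib

open FirstOrder FirstOrder.Language

universe u

namespace BoolAtoms

/-- Function symbols of the Boolean language: `0`, `1`, complement, `∩`, `∪`. -/
inductive Func : ℕ → Type
  | zero : Func 0
  | one : Func 0
  | compl : Func 1
  | inf : Func 2
  | sup : Func 2

/-- The enriching predicates: one unary predicate `C n` for every integer `n ≥ 1`. -/
inductive Rel : ℕ → Type
  | C (n : ℕ+) : Rel 1

/-- The Boolean language enriched by all the predicates `C n`. -/
abbrev L : Language := ⟨Func, Rel⟩

/-- A Boolean algebra as a structure for the enriched language: the Boolean symbols are the
Boolean operations, and `C n` holds of `x` iff there are at least `n` distinct atoms below `x`. -/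
abbrev structureOf (B : Type*) [BooleanAlgebra B] : L.Structure B where
  funMap {_} f v :=
    match f, v with
    | Func.zero, _ => ⊥
    | Func.one, _ => ⊤
    | Func.compl, v => (v 0)ᶜ
    | Func.inf, v => v 0 ⊓ v 1
    | Func.sup, v => v 0 ⊔ v 1
  RelMap {_} r v :=
    match r, v with
    | Rel.C n, v => ((n : ℕ) : ℕ∞) ≤ Set.encard {a : B | IsAtom a ∧ a ≤ v 0}

/-- The theory of infinite atomic Boolean algebras in the enriched language: all sentences that
are true in every infinite atomic Boolean algebra. -/
def theoryInfAtomic : L.Theory :=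
  {φ | ∀ (B : Type u) [BooleanAlgebra B] [Infinite B] [IsAtomic B],
    @Sentence.Realize L B (structureOf B) φ}

/-! ### The axioms -/

section Axioms

variable {α : Type}

/-- The term `0`. -/
def tZero : L.Term α := Term.func Func.zero ![]

/-- The term `1`. -/
def tOne : L.Term α := Term.func Func.one ![]

/-- The term `¬ t`. -/
def tCompl (t : L.Term α) : L.Term α := Term.func Func.compl ![t]

/-- The term `s ∩ t`. -/
def tInf (s t : L.Term α) : L.Term α := Term.func Func.inf ![s, t]

/-- The term `s ∪ t`. -/
def tSup (s t : L.Term α) : L.Term α := Term.func Func.sup ![s, t]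

end Axioms

/-- The variable `i` of a formula with `m` bound variables in scope. -/
abbrev tVar {m : ℕ} (i : Fin m) : L.Term (Empty ⊕ Fin m) := Term.var (Sum.inr i)

/-- The axioms of Boolean algebras (complemented distributive lattices). -/
def axiomsBoolean : L.Theory :=
  let x : L.Term (Empty ⊕ Fin 3) := tVar 0
  let y : L.Term (Empty ⊕ Fin 3) := tVar 1
  let z : L.Term (Empty ⊕ Fin 3) := tVar 2
  { ∀' ∀' ∀' ((tInf x y).bdEqual (tInf y x)),
    ∀' ∀' ∀' ((tSup x y).bdEqual (tSup y x)),
    ∀' ∀' ∀' ((tInf (tInf x y) z).bdEqual (tInf x (tInf y z))),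
    ∀' ∀' ∀' ((tSup (tSup x y) z).bdEqual (tSup x (tSup y z))),
    ∀' ∀' ∀' ((tInf x (tSup x y)).bdEqual x),
    ∀' ∀' ∀' ((tSup x (tInf x y)).bdEqual x),
    ∀' ∀' ∀' ((tInf x (tSup y z)).bdEqual (tSup (tInf x y) (tInf x z))),
    ∀' ∀' ∀' ((tSup x (tInf y z)).bdEqual (tInf (tSup x y) (tSup x z))),
    ∀' ∀' ∀' ((tInf x (tCompl x)).bdEqual tZero),
    ∀' ∀' ∀' ((tSup x (tCompl x)).bdEqual tOne) }

/-- The formula `s ≤ t`, that is, `s ∩ t = s`. -/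
def fLe {m : ℕ} (s t : L.Term (Empty ⊕ Fin m)) : L.BoundedFormula Empty m :=
  (tInf s t).bdEqual s

/-- The formula saying that the variable `i` is an atom: it is not `0`, and every `b` below it is
`0` or equal to it. -/
def fAtom {m : ℕ} (i : Fin m) : L.BoundedFormula Empty m :=
  ∼((tVar i).bdEqual tZero) ⊓
    ∀' (fLe (tVar (Fin.last m)) (tVar i.castSucc) ⟹
      ((tVar (Fin.last m)).bdEqual tZero ⊔ (tVar (Fin.last m)).bdEqual (tVar i.castSucc)))

/-- Every nonzero element has an atom below it. -/
def axiomAtomic : L.Sentence :=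
  ∀' (∼((tVar (0 : Fin 1)).bdEqual tZero) ⟹
    ∃' (fAtom (1 : Fin 2) ⊓ fLe (tVar (1 : Fin 2)) (tVar 0)))

/-- Existential quantification over the last `n` bound variables. -/
def exsLast {m : ℕ} : (n : ℕ) → L.BoundedFormula Empty (m + n) → L.BoundedFormula Empty m
  | 0, φ => φ
  | n + 1, φ => exsLast n φ.ex

/-- The sentence giving `C n` its meaning: for every `x`, `C n` holds of `x` iff there are
pairwise distinct atoms `y₁, …, yₙ` below `x`. -/
noncomputable def axiomC (n : ℕ+) : L.Sentence :=
  ∀' ((BoundedFormula.rel (Rel.C n) ![tVar (0 : Fin 1)]).iff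
    (exsLast (m := 1) (n : ℕ)
      ((BoundedFormula.iInf fun i : Fin n =>
          fAtom (Fin.natAdd 1 i) ⊓ fLe (tVar (Fin.natAdd 1 i)) (tVar (Fin.castAdd n 0))) ⊓
        BoundedFormula.iInf fun p : {p : Fin n × Fin n // p.1 ≠ p.2} =>
          ∼((tVar (Fin.natAdd 1 p.1.1)).bdEqual (tVar (Fin.natAdd 1 p.1.2))))))

/-- The axioms: the models are infinite Boolean algebras, every nonzero element has an atom below
it, and the predicates `C n` have their intended meaning. -/
noncomputable def axiomsInfAtomic : L.Theory :=
  axiomsBoolean ∪ L.infiniteTheory ∪ {axiomAtomic} ∪ Set.range axiomC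

/-! ### Axiomatization, quantifier elimination, decidability -/

/-- `T` is axiomatized by `A`: the two have the same consequences. -/
def IsAxiomatizedBy (T A : L.Theory) : Prop :=
  ∀ φ : L.Sentence, T ⊨ᵇ φ ↔ A ⊨ᵇ φ

/-- `T` has quantifier elimination: modulo `T`, every formula is equivalent to a quantifier-free
formula in the same free variables. -/
def HasQuantifierElimination (T : L.Theory) : Prop :=
  ∀ (n : ℕ) (φ : L.Formula (Fin n)), ∃ ψ : L.Formula (Fin n), ψ.IsQF ∧ φ ⇔[T] ψ

/-- Gödel numbers of terms. -/
def termCode {m : ℕ} : L.Term (Empty ⊕ Fin m) → ℕ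
  | .var (.inl e) => e.elim
  | .var (.inr i) => Nat.pair 0 i
  | .func Func.zero _ => Nat.pair 1 0
  | .func Func.one _ => Nat.pair 2 0
  | .func Func.compl ts => Nat.pair 3 (termCode (ts 0))
  | .func Func.inf ts => Nat.pair 4 (Nat.pair (termCode (ts 0)) (termCode (ts 1)))
  | .func Func.sup ts => Nat.pair 5 (Nat.pair (termCode (ts 0)) (termCode (ts 1)))

/-- Gödel numbers of formulas. -/
def formulaCode : {m : ℕ} → L.BoundedFormula Empty m → ℕ
  | _, .falsum => Nat.pair 0 0
  | _, .equal s t => Nat.pair 1 (Nat.pair (termCode s) (termCode t))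
  | _, .rel (Rel.C n) ts => Nat.pair 2 (Nat.pair n (termCode (ts 0)))
  | _, .imp φ ψ => Nat.pair 3 (Nat.pair (formulaCode φ) (formulaCode ψ))
  | _, .all φ => Nat.pair 4 (formulaCode φ)

/-- `T` is decidable: the set of Gödel numbers of the sentences that follow from `T` is
computable. -/
def IsDecidable (T : L.Theory) : Prop :=
  ComputablePred fun c : ℕ => ∃ φ : L.Sentence, formulaCode φ = c ∧ T ⊨ᵇ φ

theorem termCode_injective {m : ℕ} :
    Function.Injective (termCode : L.Term (Empty ⊕ Fin m) → ℕ) := by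
  intro s
  induction s with
  | var a =>
    rcases a with e | i
    · exact e.elim
    · rintro (⟨e | j⟩ | ⟨_ | _ | _ | _ | _, us⟩) h
      · exact e.elim
      all_goals simp_all [termCode, Nat.pair_eq_pair, Fin.ext_iff]
  | func f ts ih =>
    cases f <;> rintro (⟨e | j⟩ | ⟨_ | _ | _ | _ | _, us⟩) h <;> first
      | exact e.elim
      | (simp only [termCode, Nat.pair_eq_pair] at h
         first
          | (exfalso; omega)
          | (congr 1; funext i; fin_cases i <;>
              first
              | exact ih _ h.2
              | exact ih _ h.2.1
              | exact ih _ h.2.2))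

/-- Distinct sentences have distinct Gödel numbers. -/
theorem formulaCode_injective {m : ℕ} :
    Function.Injective (formulaCode : L.BoundedFormula Empty m → ℕ) := by
  intro φ
  induction φ with
  | falsum => rintro (_ | ⟨s, t⟩ | ⟨⟨n⟩, us⟩ | ⟨φ, ψ⟩ | ⟨φ⟩) h <;>
      simp_all [formulaCode, Nat.pair_eq_pair]
  | equal s t => rintro (_ | ⟨s, t⟩ | ⟨⟨n⟩, us⟩ | ⟨φ, ψ⟩ | ⟨φ⟩) h <;>
      simp_all [formulaCode, Nat.pair_eq_pair, termCode_injective.eq_iff]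
  | rel R ts =>
    obtain ⟨k⟩ := R
    rintro (_ | ⟨s, t⟩ | ⟨⟨n⟩, us⟩ | ⟨φ, ψ⟩ | ⟨φ⟩) h
    case rel.rel =>
      simp only [formulaCode, Nat.pair_eq_pair, termCode_injective.eq_iff, PNat.coe_inj] at h
      obtain ⟨-, rfl, h⟩ := h
      congr 1
      funext i
      fin_cases i
      exact h
    all_goals simp_all [formulaCode, Nat.pair_eq_pair]
  | imp φ ψ ihφ ihψ =>
    rintro (_ | ⟨s, t⟩ | ⟨⟨n⟩, us⟩ | ⟨φ', ψ'⟩ | ⟨φ'⟩) h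
    case imp.imp =>
      simp only [formulaCode, Nat.pair_eq_pair] at h
      rw [ihφ h.2.1, ihψ h.2.2]
    all_goals simp_all [formulaCode, Nat.pair_eq_pair]
  | all φ ih =>
    rintro (_ | ⟨s, t⟩ | ⟨⟨n⟩, us⟩ | ⟨φ', ψ'⟩ | ⟨φ'⟩) h
    case all.all =>
      simp only [formulaCode, Nat.pair_eq_pair] at h
      rw [ih h.2]
    all_goals simp_all [formulaCode, Nat.pair_eq_pair]

end BoolAtoms

/-! Whether an atom lies below the value of a term depends only on which of the variables it lies
below: atoms commute with the Boolean operations, so the term may be evaluated in `Prop`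
(`isAtom_le_realize_iff`). A tuple therefore partitions the atoms into finitely many cells. In an
atomic algebra, equalities of terms and the predicates `C n` only ask how many atoms lie in certain
unions of cells, counted up to a finite threshold.

The core is a back-and-forth argument. If two tuples have cells of the same sizes up to `2 * K`,
then every element added on one side can be matched on the other so that the refined cells agree up
to `K` (`Similar.exists_extension`). Hence a formula cannot distinguish tuples whose cells agree up
to its `weight`, which doubles at each quantifier (`realize_iff_of_similar`).

For sentences the only cell is the set of all atoms, which is infinite in every infinite atomic
algebra. So all these algebras satisfy the same sentences, and `Set ℕ` serves as the standard model;
this gives completeness, and the axiomatization once the models of the axioms are identified. For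
formulas, "this cell has at least `k` atoms" is the quantifier-free formula `C k` applied to a term,
so a formula is equivalent to a finite disjunction of cell-size patterns.

For decidability, the same theorem allows infinitely many atoms to be replaced by any number of them
at least the weight. A sentence with code `c` has weight at most `2 ^ c`, so it can be tested in the
finite algebra of subsets of a set with `2 ^ c` elements. -/

namespace BoolAtoms

attribute [local instance] structureOf

/-! ### Terms evaluated on atoms -/

section Terms

variable {B : Type*} [BooleanAlgebra B] {α : Type}

@[simp]
theorem realize_tZero (v : α → B) : (tZero : L.Term α).realize v = ⊥ := rfl

@[simp]
theorem realize_tOne (v : α → B) : (tOne : L.Term α).realize v = ⊤ := rfl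

@[simp]
theorem realize_tCompl (t : L.Term α) (v : α → B) : (tCompl t).realize v = (t.realize v)ᶜ := rfl

@[simp]
theorem realize_tInf (s t : L.Term α) (v : α → B) :
    (tInf s t).realize v = s.realize v ⊓ t.realize v := rfl

@[simp]
theorem realize_tSup (s t : L.Term α) (v : α → B) :
    (tSup s t).realize v = s.realize v ⊔ t.realize v := rfl

theorem relMap_C (n : ℕ+) (v : Fin 1 → B) :
    Structure.RelMap (L := L) (Rel.C n) v ↔
      ((n : ℕ) : ℕ∞) ≤ Set.encard {a : B | IsAtom a ∧ a ≤ v 0} := Iff.rfl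

/-- Induction on terms of the Boolean language. -/
theorem term_induction {motive : L.Term α → Prop} (var : ∀ i, motive (Term.var i))
    (zero : motive tZero) (one : motive tOne) (compl : ∀ t, motive t → motive (tCompl t))
    (inf : ∀ s t, motive s → motive t → motive (tInf s t))
    (sup : ∀ s t, motive s → motive t → motive (tSup s t)) (t : L.Term α) : motive t := by
  induction t with
  | var i => exact var i
  | func f ts ih =>
    cases f with
    | zero => convert zero; exact congrArg _ (funext (Fin.elim0 ·))
    | one => convert one; exact congrArg _ (funext (Fin.elim0 ·))
    | compl =>
      have := compl _ (ih 0)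
      rwa [tCompl, show ![ts 0] = ts by funext i; fin_cases i; rfl] at this
    | inf =>
      have := inf _ _ (ih 0) (ih 1)
      rwa [tInf, show ![ts 0, ts 1] = ts by funext i; fin_cases i <;> rfl] at this
    | sup =>
      have := sup _ _ (ih 0) (ih 1)
      rwa [tSup, show ![ts 0, ts 1] = ts by funext i; fin_cases i <;> rfl] at this

theorem isAtom_le_sup_iff {a x y : B} (ha : IsAtom a) : a ≤ x ⊔ y ↔ a ≤ x ∨ a ≤ y := by
  refine ⟨fun h => ?_, fun h => h.elim le_sup_of_le_left le_sup_of_le_right⟩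
  by_contra! hn
  have hx : Disjoint a x := ha.not_le_iff_disjoint.1 hn.1
  have hy : Disjoint a y := ha.not_le_iff_disjoint.1 hn.2
  exact ha.1 ((hx.sup_right hy).eq_bot_of_le h)

theorem isAtom_le_compl_iff {a x : B} (ha : IsAtom a) : a ≤ xᶜ ↔ ¬ a ≤ x := by
  rw [le_compl_iff_disjoint_right]
  exact ⟨fun h hx => ha.1 (h.eq_bot_of_le hx), fun h => ha.not_le_iff_disjoint.1 h⟩

theorem isAtom_le_finset_sup_iff {ι : Type*} {a : B} (ha : IsAtom a) (s : Finset ι) (f : ι → B) :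
    a ≤ s.sup f ↔ ∃ i ∈ s, a ≤ f i := by
  classical
  induction s using Finset.induction_on with
  | empty => simpa using ha.1
  | insert i s _ ih => simp [Finset.sup_insert, isAtom_le_sup_iff ha, ih]

/-- An atom lies below the value of a term iff the term holds of the propositions saying that the
atom lies below the values of the variables. -/
theorem isAtom_le_realize_iff {a : B} (ha : IsAtom a) (t : L.Term α) (v : α → B) :
    a ≤ t.realize v ↔ t.realize (fun i => a ≤ v i) := by
  induction t using term_induction with
  | var i => rfl
  | zero => simpa using ha.1
  | one => simp
  | compl t ih => simp [isAtom_le_compl_iff ha, ih]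
  | inf s t hs ht => simp [hs, ht]
  | sup s t hs ht => simp [isAtom_le_sup_iff ha, hs, ht]

/-- The term describing the atoms that lie below exactly those `x i` for which `S i` holds. -/
noncomputable def cellTerm [Finite α] (S : α → Prop) : L.Term α :=
  let _ := Fintype.ofFinite α
  open scoped Classical in
  ((Finset.univ : Finset α).toList.map
    fun i => if S i then Term.var i else tCompl (Term.var i)).foldr tInf tOne

theorem realize_cellTerm [Finite α] (S P : α → Prop) : (cellTerm S).realize P ↔ P = S := by
  classical
  let _ := Fintype.ofFinite α
  have key (l : List (L.Term α)) : (l.foldr tInf tOne).realize P ↔ ∀ t ∈ l, t.realize P := by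
    induction l with
    | nil => simp
    | cons t l ih => simp [ih]
  rw [cellTerm, key, funext_iff]
  simp only [List.mem_map, Finset.mem_toList, Finset.mem_univ, true_and, forall_exists_index,
    forall_apply_eq_imp_iff]
  refine forall_congr' fun i => ?_
  by_cases h : S i <;> simp [h]

end Terms

/-! ### Cells of a tuple and the back-and-forth extension -/

section Cells

variable {B B' : Type*} [BooleanAlgebra B] [BooleanAlgebra B'] {ι : Type*}

/-- The atoms that lie below exactly those `v i` for which `S i` holds. -/
def cell (v : ι → B) (S : ι → Prop) : Set B := {a | IsAtom a ∧ (fun i => a ≤ v i) = S}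

/-- This makes cell sizes expressible by the predicates `C n`, and lets cofinite parts of a cell be
cut out by an element. -/
theorem cell_eq_isAtom_le_realize {α : Type} [Finite α] (v : α → B) (S : α → Prop) :
    cell v S = {a | IsAtom a ∧ a ≤ (cellTerm S).realize v} := by
  ext a
  refine and_congr_right fun ha => ?_
  rw [isAtom_le_realize_iff ha, realize_cellTerm]

/-- Two families are similar up to `K` if corresponding cells have the same number of atoms, where
all numbers that are at least `K` are identified. -/
def Similar (K : ℕ) (v : ι → B) (v' : ι → B') : Prop :=
  ∀ (S : ι → Prop) (k : ℕ), k ≤ K → ((k : ℕ∞) ≤ (cell v S).encard ↔ (k : ℕ∞) ≤ (cell v' S).encard)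

theorem Similar.symm {K : ℕ} {v : ι → B} {v' : ι → B'} (h : Similar K v v') : Similar K v' v :=
  fun S k hk => (h S k hk).symm

theorem Similar.mono {K M : ℕ} (hKM : K ≤ M) {v : ι → B} {v' : ι → B'} (h : Similar M v v') :
    Similar K v v' :=
  fun S k hk => h S k (hk.trans hKM)

theorem exists_add_eq_of_le_add {k : ℕ} {x y : ℕ∞} (h : (k : ℕ∞) ≤ x + y) :
    ∃ i j : ℕ, i + j = k ∧ (i : ℕ∞) ≤ x ∧ (j : ℕ∞) ≤ y := by
  induction x using ENat.recTopCoe with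
  | top => exact ⟨k, 0, by simp⟩
  | coe x =>
    induction y using ENat.recTopCoe with
    | top => exact ⟨0, k, by simp⟩
    | coe y =>
      norm_cast at h
      refine ⟨min x k, k - min x k, by omega, ?_, ?_⟩ <;> norm_cast <;> omega

/-- A lower bound `k` for a sum splits as `i + j` with both parts at most `K`, so bounds truncated
at `K` still pass through sums. -/
theorem le_add_of_agree {K k : ℕ} (hk : k ≤ K) {x x' y y' : ℕ∞}
    (hx : ∀ k : ℕ, k ≤ K → (k : ℕ∞) ≤ x → (k : ℕ∞) ≤ x')
    (hy : ∀ k : ℕ, k ≤ K → (k : ℕ∞) ≤ y → (k : ℕ∞) ≤ y') (h : (k : ℕ∞) ≤ x + y) :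
    (k : ℕ∞) ≤ x' + y' := by
  obtain ⟨i, j, rfl, hi, hj⟩ := exists_add_eq_of_le_add h
  push_cast
  exact add_le_add (hx i (by omega) hi) (hy j (by omega) hj)

theorem encard_cell_insert [DecidableEq (ι → Prop)] (v : ι → B) {S : ι → Prop}
    {F : Finset (ι → Prop)} (hS : S ∉ F) :
    {a : B | IsAtom a ∧ (fun i => a ≤ v i) ∈ insert S F}.encard =
      (cell v S).encard + {a : B | IsAtom a ∧ (fun i => a ≤ v i) ∈ F}.encard := by
  rw [← Set.encard_union_eq]
  · congr 1
    ext a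
    simp [cell, ← and_or_left]
  · rw [Set.disjoint_left]
    rintro a ⟨-, rfl⟩ ⟨-, ha⟩
    exact hS ha

/-- The atoms in question form a finite disjoint union of cells, and truncated sizes are additive.
-/
theorem Similar.le_encard [Finite ι] {K : ℕ} {v : ι → B} {v' : ι → B'} (h : Similar K v v')
    (p : (ι → Prop) → Prop) {k : ℕ} (hk : k ≤ K)
    (hle : (k : ℕ∞) ≤ {a : B | IsAtom a ∧ p fun i => a ≤ v i}.encard) :
    (k : ℕ∞) ≤ {a : B' | IsAtom a ∧ p fun i => a ≤ v' i}.encard := by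
  classical
  let _ := Fintype.ofFinite (ι → Prop)
  have key (F : Finset (ι → Prop)) : ∀ k : ℕ, k ≤ K →
      (k : ℕ∞) ≤ {a : B | IsAtom a ∧ (fun i => a ≤ v i) ∈ F}.encard →
      (k : ℕ∞) ≤ {a : B' | IsAtom a ∧ (fun i => a ≤ v' i) ∈ F}.encard := by
    induction F using Finset.induction_on with
    | empty => simp
    | insert S F hS ih =>
      intro k hk
      rw [encard_cell_insert v hS, encard_cell_insert v' hS]
      exact le_add_of_agree hk (fun k hk => (h S k hk).1) ih
  simpa using key (Finset.univ.filter p) k hk (by simpa using hle)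

theorem Similar.le_encard_iff [Finite ι] {K : ℕ} {v : ι → B} {v' : ι → B'} (h : Similar K v v')
    (p : (ι → Prop) → Prop) {k : ℕ} (hk : k ≤ K) :
    (k : ℕ∞) ≤ {a : B | IsAtom a ∧ p fun i => a ≤ v i}.encard ↔
      (k : ℕ∞) ≤ {a : B' | IsAtom a ∧ p fun i => a ≤ v' i}.encard :=
  ⟨h.le_encard p hk, h.symm.le_encard p hk⟩

/-- A subset of a set `P` can be matched by a finite or cofinite subset of any set `P'` that has as
many elements as `P` when numbers from `2 * K` on are identified. -/
theorem exists_matching_subset {X Y : Type*} {K : ℕ} {P A : Set X} {P' : Set Y} (hA : A ⊆ P)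
    (h : ∀ k : ℕ, k ≤ 2 * K → ((k : ℕ∞) ≤ P.encard ↔ (k : ℕ∞) ≤ P'.encard)) :
    ∃ A' ⊆ P', (A'.Finite ∨ (P' \ A').Finite) ∧
      (∀ k : ℕ, k ≤ K → ((k : ℕ∞) ≤ A.encard ↔ (k : ℕ∞) ≤ A'.encard)) ∧
      ∀ k : ℕ, k ≤ K → ((k : ℕ∞) ≤ (P \ A).encard ↔ (k : ℕ∞) ≤ (P' \ A').encard) := by
  -- A part with fewer than `K` elements is copied exactly. This is used for `A` and, by symmetry,
  -- for its complement in `P`.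
  have small {A : Set X} (hA : A ⊆ P) (hlt : A.encard < K) : ∃ A' ⊆ P', A'.Finite ∧
      (∀ k : ℕ, k ≤ K → ((k : ℕ∞) ≤ A.encard ↔ (k : ℕ∞) ≤ A'.encard)) ∧
      ∀ k : ℕ, k ≤ K → ((k : ℕ∞) ≤ (P \ A).encard ↔ (k : ℕ∞) ≤ (P' \ A').encard) := by
    obtain ⟨n, hn⟩ := ENat.ne_top_iff_exists.1 hlt.ne_top
    rw [← hn, Nat.cast_lt] at hlt
    have hnP : (n : ℕ∞) ≤ P'.encard :=
      (h n (by omega)).1 (hn ▸ Set.encard_le_encard hA)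
    obtain ⟨A', hA', hcard⟩ := Set.exists_subset_encard_eq hnP
    refine ⟨A', hA', Set.finite_of_encard_eq_coe hcard, fun k _ => by rw [← hn, hcard],
      fun k hk => ?_⟩
    -- Adding back the `n` removed elements reduces the comparison to `P` and `P'`; since `n < K`
    -- and `k ≤ K`, the bound `k + n` stays within `2 * K`.
    have cancel (x : ℕ∞) : (k : ℕ∞) ≤ x ↔ ((k + n : ℕ) : ℕ∞) ≤ x + n := by
      push_cast
      exact (WithTop.add_le_add_iff_right (WithTop.natCast_ne_top n)).symm
    rw [cancel, cancel (P' \ A').encard]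
    nth_rw 1 [hn]
    rw [← hcard, Set.encard_sdiff_add_encard_of_subset hA, Set.encard_sdiff_add_encard_of_subset hA']
    exact h _ (by omega)
  rcases lt_or_ge A.encard K with hlt | hge
  · obtain ⟨A', h1, h2, h3⟩ := small hA hlt
    exact ⟨A', h1, .inl h2, h3⟩
  rcases lt_or_ge (P \ A).encard K with hlt | hge'
  · obtain ⟨A', h1, h2, h3, h4⟩ := small Set.sdiff_subset hlt
    refine ⟨P' \ A', Set.sdiff_subset, .inr ?_, ?_, ?_⟩
    · rwa [Set.sdiff_sdiff_right_self, Set.inter_eq_right.2 h1]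
    · rwa [Set.sdiff_sdiff_right_self, Set.inter_eq_right.2 hA] at h4
    · rwa [Set.sdiff_sdiff_right_self, Set.inter_eq_right.2 h1]
  -- Both parts have at least `K` elements, so `P'` has at least `2 * K`; any `K` of them leave at
  -- least `K` others. This is where the factor 2 is needed.
  · have hP : ((2 * K : ℕ) : ℕ∞) ≤ P'.encard := by
      rw [← h _ le_rfl, ← Set.encard_sdiff_add_encard_of_subset hA, two_mul]
      push_cast
      exact add_le_add hge' hge
    obtain ⟨A', hA', hcard⟩ := Set.exists_subset_encard_eq
      ((Nat.cast_le.2 (by omega : K ≤ 2 * K)).trans hP)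
    rw [← Set.encard_sdiff_add_encard_of_subset hA', hcard, two_mul] at hP
    push_cast at hP
    have hP := (WithTop.add_le_add_iff_right (WithTop.natCast_ne_top K)).1 hP
    have up {k : ℕ} (hk : k ≤ K) {x : ℕ∞} (hx : (K : ℕ∞) ≤ x) : (k : ℕ∞) ≤ x :=
      (Nat.cast_le.2 hk).trans hx
    exact ⟨A', hA', .inl (Set.finite_of_encard_eq_coe hcard),
      fun k hk => iff_of_true (up hk hge) (up hk hcard.ge),
      fun k hk => iff_of_true (up hk hge') (up hk hP)⟩

/-- A finite set of atoms is the set of atoms below some element. -/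
theorem exists_forall_isAtom_le_iff {A : Set B} (hA : A.Finite) (hat : ∀ a ∈ A, IsAtom a) :
    ∃ y : B, ∀ a, IsAtom a → (a ≤ y ↔ a ∈ A) := by
  refine ⟨hA.toFinset.sup id, fun a ha => ?_⟩
  rw [isAtom_le_finset_sup_iff ha]
  constructor
  · rintro ⟨b, hb, hab⟩
    rw [Set.Finite.mem_toFinset] at hb
    rcases (hat b hb).le_iff.1 hab with h | h
    · exact absurd h ha.1
    · exact h ▸ hb
  · exact fun h => ⟨a, by simpa using h, le_rfl⟩

/-- The new element splits each cell in two. Each split is matched separately in the other algebra,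
and the finitely many pieces are joined. The algebra need not be complete, which is why the matching
sets must be finite or cofinite in their cells. -/
theorem Similar.exists_extension {α : Type} [Finite α] {K : ℕ} {v : α → B} {v' : α → B'}
    (h : Similar (2 * K) v v') (x : B) :
    ∃ x' : B', ∀ (S : α → Prop) (k : ℕ), k ≤ K →
      ((k : ℕ∞) ≤ (cell v S ∩ {a | a ≤ x}).encard ↔
        (k : ℕ∞) ≤ (cell v' S ∩ {a | a ≤ x'}).encard) ∧
      ((k : ℕ∞) ≤ (cell v S \ {a | a ≤ x}).encard ↔
        (k : ℕ∞) ≤ (cell v' S \ {a | a ≤ x'}).encard) := by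
  classical
  let _ := Fintype.ofFinite (α → Prop)
  have hex (S : α → Prop) := exists_matching_subset
    (Set.inter_subset_left : cell v S ∩ {a | a ≤ x} ⊆ cell v S) (h S)
  choose A' hsub hfin hA hdiff using hex
  have hy (S : α → Prop) : ∃ y : B', ∀ a, IsAtom a → (a ≤ y ↔ a ∈ A' S) := by
    rcases hfin S with hf | hf
    · exact exists_forall_isAtom_le_iff hf fun a ha => (hsub S ha).1
    · obtain ⟨y, hy⟩ := exists_forall_isAtom_le_iff hf fun a ha => ha.1.1
      -- The whole cell is the set of atoms below a term, so a cofinite part is that term minus the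
      -- join of the finitely many excluded atoms.
      refine ⟨(cellTerm S).realize v' ⊓ yᶜ, fun a ha => ?_⟩
      rw [le_inf_iff, isAtom_le_compl_iff ha, hy a ha]
      have := Set.ext_iff.1 (cell_eq_isAtom_le_realize v' S) a
      simp only [Set.mem_ofPred_eq, ha, true_and] at this
      rw [← this, Set.mem_sdiff]
      have := @hsub S a
      tauto
  choose y hy using hy
  -- Joining the pieces adds nothing to a given cell because distinct cells are disjoint.
  have hcell (S : α → Prop) : cell v' S ∩ {a | a ≤ Finset.univ.sup y} = A' S := by
    ext a
    constructor
    · rintro ⟨ha, hle⟩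
      obtain ⟨S', -, hS'⟩ := (isAtom_le_finset_sup_iff ha.1 _ _).1 hle
      rw [hy S' a ha.1] at hS'
      have := (hsub S' hS').2
      rwa [← ha.2, this]
    · intro ha
      have := hsub S ha
      exact ⟨this, (isAtom_le_finset_sup_iff this.1 _ _).2 ⟨S, Finset.mem_univ _,
        (hy S a this.1).2 ha⟩⟩
  refine ⟨Finset.univ.sup y, fun S k hk => ⟨?_, ?_⟩⟩
  · rw [hcell]
    exact hA S k hk
  · have := hdiff S k hk
    rwa [← hcell, Set.sdiff_self_inter, Set.sdiff_self_inter] at this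

end Cells

/-! ### Cell sizes determine the truth of formulas -/

section Formulas

variable {α : Type}

/-- How precisely the cells have to be counted in order to determine the truth of a formula. -/
def weight : {m : ℕ} → L.BoundedFormula α m → ℕ
  | _, .falsum => 0
  | _, .equal _ _ => 1
  | _, .rel (Rel.C n) _ => n
  | _, .imp φ ψ => max (weight φ) (weight ψ)
  | _, .all φ => 2 * weight φ

variable {B B' : Type*} [BooleanAlgebra B] [BooleanAlgebra B']

theorem eq_iff_forall_isAtom [IsAtomic B] {x y : B} :
    x = y ↔ ¬ ((1 : ℕ) : ℕ∞) ≤ {a : B | IsAtom a ∧ ¬ (a ≤ x ↔ a ≤ y)}.encard := by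
  rw [BooleanAlgebra.eq_iff_atom_le_iff, Nat.cast_one, Set.one_le_encard_iff_nonempty,
    Set.not_nonempty_iff_eq_empty,
    Set.eq_empty_iff_forall_notMem]
  simp [not_not]

open scoped Classical in
-- This translates the splitting of cells by one element into the cells of the extended assignment.
theorem cell_snoc {α : Type*} {m : ℕ} (v : α → B) (xs : Fin m → B) (x : B)
    (S : α ⊕ Fin (m + 1) → Prop) :
    cell (Sum.elim v (Fin.snoc xs x : Fin (m + 1) → B)) S =
      if S (.inr (Fin.last m)) then cell (Sum.elim v xs) (S ∘ Sum.map id Fin.castSucc) ∩ {a | a ≤ x}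
      else cell (Sum.elim v xs) (S ∘ Sum.map id Fin.castSucc) \ {a | a ≤ x} := by
  ext a
  split_ifs with h <;>
  · simp only [cell, funext_iff, Sum.forall, Fin.forall_fin_succ', Sum.elim_inl, Sum.elim_inr,
      Fin.snoc_castSucc, Fin.snoc_last, Set.mem_ofPred_eq, Set.mem_inter_iff, Set.mem_sdiff,
      Function.comp_apply, Sum.map_inl, Sum.map_inr, h, id_eq, eq_iff_iff, iff_true, iff_false]
    tauto

theorem Similar.exists_snoc [Finite α] {m K : ℕ} {v : α → B} {xs : Fin m → B} {v' : α → B'}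
    {xs' : Fin m → B'} (h : Similar (2 * K) (Sum.elim v xs) (Sum.elim v' xs')) (x : B) :
    ∃ x' : B', Similar K (Sum.elim v (Fin.snoc xs x : Fin (m + 1) → B))
      (Sum.elim v' (Fin.snoc xs' x' : Fin (m + 1) → B')) := by
  obtain ⟨x', hx'⟩ := h.exists_extension x
  refine ⟨x', fun S k hk => ?_⟩
  rw [cell_snoc, cell_snoc]
  split_ifs
  · exact (hx' _ k hk).1
  · exact (hx' _ k hk).2

/-- Similarity up to the weight of a formula determines the truth of the formula. -/
theorem realize_iff_of_similar [Finite α] [IsAtomic B] [IsAtomic B'] {m : ℕ}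
    (φ : L.BoundedFormula α m) : ∀ {v : α → B} {xs : Fin m → B} {v' : α → B'} {xs' : Fin m → B'},
      Similar (weight φ) (Sum.elim v xs) (Sum.elim v' xs') →
        (φ.Realize v xs ↔ φ.Realize v' xs') := by
  induction φ with
  | falsum => exact fun _ => Iff.rfl
  | equal s t =>
    intro v xs v' xs' h
    simp only [BoundedFormula.Realize]
    rw [eq_iff_forall_isAtom, eq_iff_forall_isAtom]
    -- Equality says that no atom separates the two terms. The separating atoms are a union of
    -- cells, so counting up to 1 suffices.
    have := h.le_encard_iff (fun P => ¬ (s.realize P ↔ t.realize P)) (k := 1) le_rfl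
    convert not_congr this using 4 <;>
    · ext a
      refine and_congr_right fun ha => ?_
      rw [isAtom_le_realize_iff ha, isAtom_le_realize_iff ha]
  | rel R ts =>
    intro v xs v' xs' h
    obtain ⟨n⟩ := R
    simp only [BoundedFormula.Realize]
    rw [relMap_C, relMap_C]
    have := h.le_encard_iff (fun P => (ts 0).realize P) (k := n) le_rfl
    convert this using 3 <;>
    · ext a
      refine and_congr_right fun ha => ?_
      rw [isAtom_le_realize_iff ha]
  | imp φ ψ hφ hψ =>
    intro v xs v' xs' h
    exact imp_congr (hφ (h.mono (le_max_left _ _))) (hψ (h.mono (le_max_right _ _)))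
  | @all m φ ih =>
    intro v xs v' xs' h
    rw [BoundedFormula.realize_all, BoundedFormula.realize_all]
    constructor
    · intro H x'
      obtain ⟨x, hx⟩ := Similar.exists_snoc h.symm x'
      exact (ih hx.symm).1 (H x)
    · intro H x
      obtain ⟨x', hx⟩ := Similar.exists_snoc h x
      exact (ih hx).2 (H x')

theorem similar_of_isEmpty {ι : Type*} [IsEmpty ι] {K : ℕ}
    (hB : (K : ℕ∞) ≤ {a : B | IsAtom a}.encard) (hB' : (K : ℕ∞) ≤ {a : B' | IsAtom a}.encard)
    (v : ι → B) (v' : ι → B') : Similar K v v' := by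
  intro S k hk
  have hk : (k : ℕ∞) ≤ K := Nat.cast_le.2 hk
  simpa [cell, Subsingleton.elim _ S] using iff_of_true (hk.trans hB) (hk.trans hB')

/-- An element of an atomic algebra is determined by the atoms below it, so finitely many atoms
would allow only finitely many elements. -/
theorem encard_isAtom [IsAtomic B] [Infinite B] : {a : B | IsAtom a}.encard = ⊤ := by
  rw [Set.encard_eq_top_iff]
  intro hfin
  have : Function.Injective fun x : B => {a : B | IsAtom a ∧ a ≤ x} := by
    intro x y hxy
    rw [BooleanAlgebra.eq_iff_atom_le_iff]
    exact fun a ha => by simpa [ha] using Set.ext_iff.1 hxy a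
  exact Set.infinite_range_of_injective this
    (hfin.finite_subsets.subset (by rintro _ ⟨x, rfl⟩ a ha; exact ha.1))

theorem realize_sentence_iff_of_le_encard [IsAtomic B] [IsAtomic B'] (φ : L.Sentence)
    (hB : (weight φ : ℕ∞) ≤ {a : B | IsAtom a}.encard)
    (hB' : (weight φ : ℕ∞) ≤ {a : B' | IsAtom a}.encard) :
    φ.Realize B ↔ φ.Realize B' :=
  realize_iff_of_similar φ (similar_of_isEmpty hB hB' _ _)

end Formulas

end BoolAtoms

namespace BoolAtoms

/-! ### Models of the axioms -/

section Axioms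

variable {M : Type*}

theorem realize_exsLast [L.Structure M] {m : ℕ} (n : ℕ) (φ : L.BoundedFormula Empty (m + n))
    (v : Empty → M) (xs : Fin m → M) :
    (exsLast n φ).Realize v xs ↔ ∃ ys : Fin n → M, φ.Realize v (Fin.append xs ys) := by
  induction n with
  | zero =>
    simp only [exsLast]
    have (ys : Fin 0 → M) : Fin.append xs ys = xs := by
      rw [Subsingleton.elim ys Fin.elim0, Fin.append_elim0]
      rfl
    simp [this]
  | succ n ih =>
    simp only [exsLast, ih, BoundedFormula.realize_ex]
    constructor
    · rintro ⟨ys, a, h⟩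
      exact ⟨Fin.snoc ys a, by rwa [Fin.append_snoc]⟩
    · rintro ⟨ys, h⟩
      refine ⟨Fin.init ys, ys (Fin.last n), ?_⟩
      rwa [← Fin.append_snoc, Fin.snoc_init_self]

theorem model_axiomsBoolean_iff [L.Structure M] :
    M ⊨ axiomsBoolean ↔
      let inf (x y : M) : M := Structure.funMap (L := L) Func.inf ![x, y]
      let sup (x y : M) : M := Structure.funMap (L := L) Func.sup ![x, y]
      let compl (x : M) : M := Structure.funMap (L := L) Func.compl ![x]
      let zero : M := Structure.funMap (L := L) Func.zero ![]
      let one : M := Structure.funMap (L := L) Func.one ![]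
      (∀ x y, inf x y = inf y x) ∧ (∀ x y, sup x y = sup y x) ∧
      (∀ x y z, inf (inf x y) z = inf x (inf y z)) ∧
      (∀ x y z, sup (sup x y) z = sup x (sup y z)) ∧
      (∀ x y, inf x (sup x y) = x) ∧ (∀ x y, sup x (inf x y) = x) ∧
      (∀ x y z, inf x (sup y z) = sup (inf x y) (inf x z)) ∧
      (∀ x y z, sup x (inf y z) = inf (sup x y) (sup x z)) ∧
      (∀ x, inf x (compl x) = zero) ∧ (∀ x, sup x (compl x) = one) := by
  -- Every axiom is closed with three quantifiers. The vacuous ones are removed by reusing `x`, so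
  -- `M` need not be assumed nonempty.
  have h2 {p : M → M → Prop} : (∀ x y, M → p x y) ↔ ∀ x y, p x y :=
    ⟨fun h x y => h x y x, fun h x y _ => h x y⟩
  have h1 {p : M → Prop} : (∀ x, M → M → p x) ↔ ∀ x, p x := ⟨fun h x => h x x x, fun h x _ _ => h x⟩
  have c0 (v : Fin 0 → L.Term (Empty ⊕ Fin 3)) (w : Empty ⊕ Fin 3 → M) :
      (fun i => (v i).realize w) = ![] := Subsingleton.elim _ _
  have c1 (s : L.Term (Empty ⊕ Fin 3)) (w : Empty ⊕ Fin 3 → M) :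
      (fun i => ((![s] : Fin 1 → _) i).realize w) = ![s.realize w] := by
    funext i; fin_cases i; rfl
  have c2 (s t : L.Term (Empty ⊕ Fin 3)) (w : Empty ⊕ Fin 3 → M) :
      (fun i => ((![s, t] : Fin 2 → _) i).realize w) = ![s.realize w, t.realize w] := by
    funext i; fin_cases i <;> rfl
  have e (x y z : M) :
      (Fin.snoc (Fin.snoc (Fin.snoc (default : Fin 0 → M) x) y) z : Fin 3 → M) 0 = x ∧
      (Fin.snoc (Fin.snoc (Fin.snoc (default : Fin 0 → M) x) y) z : Fin 3 → M) 1 = y ∧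
      (Fin.snoc (Fin.snoc (Fin.snoc (default : Fin 0 → M) x) y) z : Fin 3 → M) 2 = z :=
    ⟨rfl, rfl, rfl⟩
  simp only [axiomsBoolean, Theory.model_iff, Set.mem_insert_iff, Set.mem_singleton_iff,
    forall_eq_or_imp, forall_eq, Sentence.Realize, Formula.Realize, BoundedFormula.realize_all,
    BoundedFormula.realize_bdEqual, tInf, tSup, tCompl, tZero, tOne, tVar, Term.realize, c0, c1, c2,
    Sum.elim_inr, e, h1, h2]

/-- The Boolean algebra given by a model of the axioms of Boolean algebras. -/
abbrev booleanAlgebraOfModel [L.Structure M] (h : M ⊨ axiomsBoolean) : BooleanAlgebra M :=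
  have h := model_axiomsBoolean_iff.1 h
  let lat : Lattice M := @Lattice.mk' M
    ⟨fun x y => Structure.funMap (L := L) Func.sup ![x, y]⟩
    ⟨fun x y => Structure.funMap (L := L) Func.inf ![x, y]⟩
    h.2.1 h.2.2.2.1 h.1 h.2.2.1 h.2.2.2.2.2.1 h.2.2.2.2.1
  { DistribLattice.ofInfSupLe (α := M) fun x y z => (h.2.2.2.2.2.2.1 x y z).le with
    compl := fun x => Structure.funMap (L := L) Func.compl ![x]
    bot := Structure.funMap (L := L) Func.zero ![]
    top := Structure.funMap (L := L) Func.one ![]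
    bot_le := fun x => (h.2.2.2.2.2.2.2.2.1 x).symm.trans_le inf_le_left
    le_top := fun x => le_sup_left.trans_eq (h.2.2.2.2.2.2.2.2.2 x)
    inf_compl_le_bot := fun x => (h.2.2.2.2.2.2.2.2.1 x).le
    top_le_sup_compl := fun x => (h.2.2.2.2.2.2.2.2.2 x).ge }

theorem funMap_booleanAlgebraOfModel [L.Structure M] (h : M ⊨ axiomsBoolean) {n : ℕ}
    (f : L.Functions n) (v : Fin n → M) :
    Structure.funMap f v = (@structureOf M (booleanAlgebraOfModel h)).funMap f v := by
  cases f with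
  | zero => exact congrArg _ (Subsingleton.elim _ _)
  | one => exact congrArg _ (Subsingleton.elim _ _)
  | compl => exact congrArg _ (by funext i; fin_cases i; rfl)
  | inf => exact congrArg _ (by funext i; fin_cases i <;> rfl)
  | sup => exact congrArg _ (by funext i; fin_cases i <;> rfl)

theorem le_encard_iff_exists_injective {n : ℕ} {s : Set M} :
    (n : ℕ∞) ≤ s.encard ↔ ∃ ys : Fin n → M, (∀ i, ys i ∈ s) ∧ Function.Injective ys := by
  constructor
  · intro h
    obtain ⟨t, hts, ht⟩ := Set.exists_subset_encard_eq h
    have hfin := Set.finite_of_encard_eq_coe ht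
    have : t.ncard = n := by rw [Set.ncard, ht]; rfl
    have e : Fin n ≃ t := by
      have := hfin.to_subtype
      exact (Finite.equivFinOfCardEq (by rwa [Nat.card_coe_set_eq])).symm
    exact ⟨fun i => e i, fun i => hts (e i).2, Subtype.val_injective.comp e.injective⟩
  · rintro ⟨ys, hys, hinj⟩
    have h1 := Set.encard_le_encard (Set.range_subset_iff.2 hys)
    rw [← Set.image_univ, hinj.encard_image, Set.encard_univ] at h1
    simpa using h1

section Boolean

variable [BooleanAlgebra M] [L.Structure M]

/-- The function symbols are interpreted by the operations of the Boolean algebra. -/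
def FunMapBoolean (M : Type*) [BooleanAlgebra M] [L.Structure M] : Prop :=
  ∀ {n : ℕ} (f : L.Functions n) (v : Fin n → M),
    Structure.funMap f v = (structureOf M).funMap f v

theorem FunMapBoolean.model_axiomsBoolean (hM : FunMapBoolean M) : M ⊨ axiomsBoolean := by
  rw [model_axiomsBoolean_iff]
  have h0 : Structure.funMap (L := L) Func.zero ![] = (⊥ : M) := hM _ _
  have h1 : Structure.funMap (L := L) Func.one ![] = (⊤ : M) := hM _ _
  have h2 (x : M) : Structure.funMap (L := L) Func.compl ![x] = xᶜ := hM _ _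
  have h3 (x y : M) : Structure.funMap (L := L) Func.inf ![x, y] = x ⊓ y := hM _ _
  have h4 (x y : M) : Structure.funMap (L := L) Func.sup ![x, y] = x ⊔ y := hM _ _
  simp only [h0, h1, h2, h3, h4]
  exact ⟨inf_comm, sup_comm, inf_assoc, sup_assoc, fun _ _ => inf_sup_self, fun _ _ => sup_inf_self,
    inf_sup_left, sup_inf_left, inf_compl_self, fun _ => sup_compl_eq_top⟩

theorem FunMapBoolean.realize_fLe (hM : FunMapBoolean M) {m : ℕ} (s t : L.Term (Empty ⊕ Fin m))
    (v : Empty → M) (xs : Fin m → M) :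
    (fLe s t).Realize v xs ↔ s.realize (Sum.elim v xs) ≤ t.realize (Sum.elim v xs) := by
  rw [← inf_eq_left, fLe, BoundedFormula.realize_bdEqual, tInf, Term.realize, hM]
  rfl

theorem FunMapBoolean.realize_tZero (hM : FunMapBoolean M) {α : Type} (v : α → M) :
    (tZero : L.Term α).realize v = ⊥ := by
  rw [tZero, Term.realize, hM]
  rfl

theorem FunMapBoolean.realize_fAtom (hM : FunMapBoolean M) {m : ℕ} (i : Fin m) (v : Empty → M)
    (xs : Fin m → M) :
    (fAtom i).Realize v xs ↔ IsAtom (xs i) := by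
  simp only [fAtom, BoundedFormula.realize_inf, BoundedFormula.realize_not,
    BoundedFormula.realize_bdEqual, BoundedFormula.realize_all, BoundedFormula.realize_imp,
    BoundedFormula.realize_sup, hM.realize_fLe, hM.realize_tZero, tVar, Term.realize_var,
    Sum.elim_inr, Fin.snoc_last, Fin.snoc_castSucc]
  constructor
  · rintro ⟨h0, h⟩
    exact ⟨h0, fun b hb => (h b hb.le).resolve_right hb.ne⟩
  · exact fun h => ⟨h.1, fun b hb => h.le_iff.1 hb⟩

theorem FunMapBoolean.realize_axiomAtomic (hM : FunMapBoolean M) :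
    axiomAtomic.Realize M ↔ IsAtomic M := by
  have e0 (x : M) : (Fin.snoc (default : Fin 0 → M) x : Fin 1 → M) 0 = x := rfl
  have e1 (x y : M) : (Fin.snoc (Fin.snoc (default : Fin 0 → M) x) y : Fin 2 → M) 0 = x := rfl
  have e2 (x y : M) : (Fin.snoc (Fin.snoc (default : Fin 0 → M) x) y : Fin 2 → M) 1 = y := rfl
  simp only [axiomAtomic, Sentence.Realize, Formula.Realize, BoundedFormula.realize_all,
    BoundedFormula.realize_imp, BoundedFormula.realize_not, BoundedFormula.realize_bdEqual,
    BoundedFormula.realize_ex, BoundedFormula.realize_inf, hM.realize_fAtom, hM.realize_fLe,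
    hM.realize_tZero, tVar, Term.realize_var, Sum.elim_inr, e0, e1, e2]
  exact ⟨fun h => ⟨fun x => or_iff_not_imp_left.2 (h x)⟩,
    fun h x hx => (h.eq_bot_or_exists_atom_le x).resolve_left hx⟩

theorem FunMapBoolean.realize_axiomC (hM : FunMapBoolean M) (n : ℕ+) :
    (axiomC n).Realize M ↔ ∀ v : Fin 1 → M,
      Structure.RelMap (L := L) (Rel.C n) v ↔ (structureOf M).RelMap (Rel.C n) v := by
  have e (v : Fin 1 → M) : (Fin.snoc (default : Fin 0 → M) (v 0) : Fin 1 → M) = v := by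
    funext i; fin_cases i; rfl
  have hall {p : (Fin 1 → M) → Prop} :
      (∀ x, p (Fin.snoc (default : Fin 0 → M) x : Fin 1 → M)) ↔ ∀ v, p v :=
    ⟨fun h v => by simpa only [e] using h (v 0), fun h x => h _⟩
  rw [axiomC, Sentence.Realize, Formula.Realize, BoundedFormula.realize_all, hall]
  refine forall_congr' fun v => ?_
  rw [BoundedFormula.realize_iff]
  refine iff_congr ?_ ?_
  · rw [BoundedFormula.Realize]
    exact iff_of_eq (congrArg _ (by funext i; fin_cases i; rfl))
  · rw [realize_exsLast, show (structureOf M).RelMap (Rel.C n) v ↔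
      ((n : ℕ) : ℕ∞) ≤ Set.encard {a : M | IsAtom a ∧ a ≤ v 0} from Iff.rfl,
      le_encard_iff_exists_injective]
    refine exists_congr fun ys => ?_
    simp only [BoundedFormula.realize_inf, BoundedFormula.realize_iInf, hM.realize_fAtom,
      hM.realize_fLe, BoundedFormula.realize_not, BoundedFormula.realize_bdEqual, tVar,
      Term.realize_var, Sum.elim_inr, Fin.append_right, Fin.append_left]
    refine and_congr Iff.rfl ⟨fun h i j hij => ?_, fun h p hp => p.2 (h hp)⟩
    by_contra hne
    exact h ⟨(i, j), hne⟩ hij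

theorem FunMapBoolean.model_iff (hM : FunMapBoolean M) : M ⊨ axiomsInfAtomic ↔
    Infinite M ∧ IsAtomic M ∧ ‹L.Structure M› = structureOf M := by
  simp only [axiomsInfAtomic, Theory.model_union_iff, Theory.model_singleton_iff,
    model_infiniteTheory_iff, hM.model_axiomsBoolean, hM.realize_axiomAtomic, true_and, and_assoc]
  refine and_congr_right fun _ => and_congr_right fun _ => ?_
  simp only [Theory.model_iff, Set.forall_mem_range, hM.realize_axiomC]
  -- The function symbols already agree by `hM`, so equality of the two structures amounts to
  -- agreement on every `C n`.
  constructor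
  · intro h
    ext n f v
    · exact hM f v
    · cases f
      exact h _ v
  · intro h n v
    rw [h]

end Boolean

/-- The models of the axioms are the infinite atomic Boolean algebras. -/
theorem model_axiomsInfAtomic_iff (S : L.Structure M) :
    M ⊨ axiomsInfAtomic ↔
      Infinite M ∧ ∃ _ : BooleanAlgebra M, IsAtomic M ∧ S = structureOf M := by
  constructor
  · intro h
    have hB : M ⊨ axiomsBoolean :=
      h.mono (by simp only [axiomsInfAtomic, Set.union_assoc]; exact Set.subset_union_left)
    let _ := booleanAlgebraOfModel hB
    have hM : FunMapBoolean M := funMap_booleanAlgebraOfModel hB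
    obtain ⟨h1, h2⟩ := hM.model_iff.1 h
    exact ⟨h1, _, h2⟩
  · rintro ⟨h1, _, h2, rfl⟩
    let _ := structureOf M
    exact FunMapBoolean.model_iff (fun _ _ => rfl) |>.2 ⟨h1, h2, rfl⟩

end Axioms

end BoolAtoms

namespace BoolAtoms

attribute [local instance] structureOf

/-! ### Completeness and axiomatization -/

section Completeness

theorem realize_sentence_iff {B B' : Type*} [BooleanAlgebra B] [BooleanAlgebra B'] [IsAtomic B]
    [IsAtomic B'] [Infinite B] [Infinite B'] (φ : L.Sentence) : φ.Realize B ↔ φ.Realize B' :=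
  realize_sentence_iff_of_le_encard φ (by simp [encard_isAtom]) (by simp [encard_isAtom])

theorem axiomsInfAtomic_subset : axiomsInfAtomic ⊆ theoryInfAtomic.{u} := by
  intro φ hφ B _ _ _
  have := (model_axiomsInfAtomic_iff (structureOf B)).2 ⟨‹_›, ‹_›, ‹_›, rfl⟩
  exact this.realize_of_mem φ hφ

theorem mem_theoryInfAtomic_iff (φ : L.Sentence) :
    φ ∈ theoryInfAtomic.{u} ↔ φ.Realize (Set ℕ) := by
  constructor
  · intro h
    -- The theory quantifies over algebras in universe `u`, so a copy of the standard model in that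
    -- universe is used.
    exact (realize_sentence_iff φ).1 (h (Set (ULift.{u} ℕ)))
  · intro h B _ _ _
    exact (realize_sentence_iff φ).1 h

theorem model_theoryInfAtomic : Set ℕ ⊨ theoryInfAtomic.{u} :=
  ⟨fun φ hφ => (mem_theoryInfAtomic_iff φ).1 hφ⟩

theorem model_axiomsInfAtomic : Set ℕ ⊨ axiomsInfAtomic :=
  (model_axiomsInfAtomic_iff _).2 ⟨inferInstance, inferInstance, inferInstance, rfl⟩

/-- Stated for any theory between the axioms and the theory of `Set ℕ`, so that it applies both to
the axioms and to the full theory. -/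
theorem models_iff_realize {T : L.Theory} (hT : axiomsInfAtomic ⊆ T) (hN : Set ℕ ⊨ T)
    (φ : L.Sentence) : T ⊨ᵇ φ ↔ φ.Realize (Set ℕ) := by
  rw [Theory.models_sentence_iff]
  constructor
  · intro h
    exact h (Theory.ModelType.of T (Set ℕ))
  · rintro h @⟨M, S, hM, _⟩
    obtain ⟨_, _, _, rfl⟩ := (model_axiomsInfAtomic_iff S).1 (hM.mono hT)
    exact (realize_sentence_iff φ).1 h

theorem theoryInfAtomic_models_iff (φ : L.Sentence) :
    theoryInfAtomic.{u} ⊨ᵇ φ ↔ φ.Realize (Set ℕ) :=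
  models_iff_realize axiomsInfAtomic_subset model_theoryInfAtomic φ

theorem isComplete_theoryInfAtomic : theoryInfAtomic.{u}.IsComplete := by
  have := model_theoryInfAtomic.{u}
  refine ⟨⟨Theory.ModelType.of _ (Set ℕ)⟩, fun φ => ?_⟩
  rw [theoryInfAtomic_models_iff, theoryInfAtomic_models_iff, Sentence.realize_not]
  exact em _

theorem isAxiomatizedBy_axiomsInfAtomic :
    IsAxiomatizedBy theoryInfAtomic.{u} axiomsInfAtomic := fun φ => by
  rw [theoryInfAtomic_models_iff, models_iff_realize subset_rfl model_axiomsInfAtomic]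

end Completeness

/-! ### Quantifier elimination -/

section QuantifierElimination

theorem isQF_iSup {α β : Type*} {n : ℕ} [Finite β] {f : β → L.BoundedFormula α n}
    (h : ∀ b, (f b).IsQF) : (BoundedFormula.iSup f).IsQF := by
  rw [BoundedFormula.iSup]
  generalize Finset.toList _ = l
  induction l with
  | nil => exact BoundedFormula.isQF_bot
  | cons b l ih => exact (h b).sup ih

theorem isQF_iInf {α β : Type*} {n : ℕ} [Finite β] {f : β → L.BoundedFormula α n}
    (h : ∀ b, (f b).IsQF) : (BoundedFormula.iInf f).IsQF := by
  rw [BoundedFormula.iInf]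
  generalize Finset.toList _ = l
  induction l with
  | nil => exact BoundedFormula.IsQF.top
  | cons b l ih => exact (h b).inf ih

variable {B B' : Type*} [BooleanAlgebra B] [BooleanAlgebra B']

theorem cell_sumElim_of_isEmpty {ι : Type*} (v : ι → B) (xs : Fin 0 → B) (S : ι ⊕ Fin 0 → Prop) :
    cell (Sum.elim v xs) S = cell v (S ∘ Sum.inl) := by
  ext a
  simp [cell, funext_iff]

theorem Similar.sumElim {ι : Type*} {K : ℕ} {v : ι → B} {v' : ι → B'} (h : Similar K v v')
    (xs : Fin 0 → B) (xs' : Fin 0 → B') : Similar K (Sum.elim v xs) (Sum.elim v' xs') := by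
  intro S k hk
  rw [cell_sumElim_of_isEmpty, cell_sumElim_of_isEmpty]
  exact h _ k hk

variable {α : Type} [Finite α] {K : ℕ}

/-- The formula saying that the cell given by `j.1` has more than `j.2` atoms. -/
noncomputable def cellFormula (j : (α → Prop) × Fin K) : L.Formula α :=
  Relations.formula₁ (L := L) (Rel.C (j.2 : ℕ).succPNat) (cellTerm j.1)

theorem realize_cellFormula (j : (α → Prop) × Fin K) (v : α → B) :
    (cellFormula j).Realize v ↔ ((j.2 + 1 : ℕ) : ℕ∞) ≤ (cell v j.1).encard := by
  rw [cellFormula, Formula.realize_rel₁, relMap_C, cell_eq_isAtom_le_realize]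
  rfl

theorem isQF_cellFormula (j : (α → Prop) × Fin K) : (cellFormula j).IsQF :=
  (BoundedFormula.IsAtomic.rel _ _).isQF

theorem similar_of_forall_cellFormula {v : α → B} {v' : α → B'}
    (h : ∀ j : (α → Prop) × Fin K, (cellFormula j).Realize v ↔ (cellFormula j).Realize v') :
    Similar K v v' := by
  rintro S (_ | k) hk
  · simp
  · simpa only [realize_cellFormula] using h (S, ⟨k, hk⟩)

open scoped Classical in
/-- A quantifier-free formula equivalent to `φ`: the disjunction of the complete descriptions of
the sizes of cells, up to the weight of `φ`, of the tuples that satisfy `φ` in atomic Boolean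
algebras. -/
noncomputable def elimination (φ : L.Formula α) : L.Formula α :=
  BoundedFormula.iSup fun p : {p : (α → Prop) × Fin (weight φ) → Prop //
      ∃ (B : Type) (_ : BooleanAlgebra B) (_ : IsAtomic B) (v : α → B),
        φ.Realize v ∧ ∀ j, (cellFormula j).Realize v ↔ p j} =>
    BoundedFormula.iInf fun j => if p.1 j then cellFormula j else ∼(cellFormula j)

theorem isQF_elimination (φ : L.Formula α) : (elimination φ).IsQF := by
  refine isQF_iSup fun p => isQF_iInf fun j => ?_
  split_ifs
  · exact isQF_cellFormula j
  · exact (isQF_cellFormula j).not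

open scoped Classical in
-- A tuple matching a listed pattern is similar, up to the weight of `φ`, to the tuple witnessing
-- that pattern, so both satisfy `φ`. Conversely, a tuple satisfying `φ` witnesses its own pattern.
theorem realize_elimination {B : Type} [BooleanAlgebra B] [IsAtomic B] (φ : L.Formula α)
    (v : α → B) : (elimination φ).Realize v ↔ φ.Realize v := by
  have hp (p : (α → Prop) × Fin (weight φ) → Prop) :
      (∀ j, BoundedFormula.Realize (if p j then cellFormula j else ∼(cellFormula j)) v default) ↔
        ∀ j, (cellFormula j).Realize v ↔ p j := by
    refine forall_congr' fun j => ?_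
    split_ifs with h
    · simp [h, Formula.Realize]
    · simp [h, Formula.Realize]
  rw [elimination, Formula.Realize, BoundedFormula.realize_iSup]
  simp only [BoundedFormula.realize_iInf, hp, Subtype.exists]
  constructor
  · rintro ⟨p, ⟨B', _, _, v', hφ, hv'⟩, hv⟩
    have h : Similar (weight φ) v v' :=
      similar_of_forall_cellFormula fun j => (hv j).trans (hv' j).symm
    exact (realize_iff_of_similar φ (h.sumElim _ _)).2 hφ
  · intro h
    exact ⟨fun j => (cellFormula j).Realize v, ⟨B, _, ‹_›, v, h, fun _ => Iff.rfl⟩, fun _ => Iff.rfl⟩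

theorem hasQuantifierElimination_theoryInfAtomic :
    HasQuantifierElimination theoryInfAtomic.{u} := by
  refine fun n φ => ⟨elimination φ, isQF_elimination φ, ?_⟩
  rintro @⟨M, S, hM, _⟩ v xs
  obtain ⟨_, _, _, rfl⟩ := (model_axiomsInfAtomic_iff S).1 (hM.mono axiomsInfAtomic_subset)
  rw [Subsingleton.elim xs default, BoundedFormula.realize_iff]
  exact (realize_elimination φ v).symm

end QuantifierElimination

/-! ### Evaluating Gödel numbers in finite powerset algebras -/

section FiniteEvaluation

/-- The value at the `i`-th atom of the term with Gödel number `n`, when the `j`-th variable is the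
set whose elements are the positions of the binary digits `1` of the `j`-th number in the list.
It is `none` if `n` is not the Gödel number of a term in the variables that are given a value. -/
def termVal (i : ℕ) (v : List ℕ) (n : ℕ) : Option Bool :=
  -- The guard makes the recursion terminate. It never blocks a genuine subterm, whose code is
  -- smaller because the tag of a compound term is nonzero.
  let rec' (k : ℕ) : Option Bool := if k < n then termVal i v k else none
  if n.unpair.1 = 0 then v[n.unpair.2]?.map fun x => x.testBit i
  else if n.unpair.1 = 1 then if n.unpair.2 = 0 then some false else none
  else if n.unpair.1 = 2 then if n.unpair.2 = 0 then some true else none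
  else if n.unpair.1 = 3 then (rec' n.unpair.2).map not
  else if n.unpair.1 = 4 then
    Option.map₂ and (rec' n.unpair.2.unpair.1) (rec' n.unpair.2.unpair.2)
  else if n.unpair.1 = 5 then
    Option.map₂ or (rec' n.unpair.2.unpair.1) (rec' n.unpair.2.unpair.2)
  else none

/-- The value of an atomic formula in the algebra of subsets of `{0, …, N - 1}`, or `none` if `c` is
not the Gödel number of an atomic formula in the variables that are given a value. -/
def atomicVal (N c : ℕ) (v : List ℕ) : Option Bool :=
  if c.unpair.1 = 0 then if c.unpair.2 = 0 then some false else none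
  else if c.unpair.1 = 1 then
    -- Well-formedness is tested at position 0, since comparing values alone would also accept two
    -- malformed codes with value `none`.
    if (termVal 0 v c.unpair.2.unpair.1).isSome ∧ (termVal 0 v c.unpair.2.unpair.2).isSome then
      some (decide (∀ i < N, termVal i v c.unpair.2.unpair.1 = termVal i v c.unpair.2.unpair.2))
    else none
  else if c.unpair.1 = 2 then
    if c.unpair.2.unpair.1 ≠ 0 ∧ (termVal 0 v c.unpair.2.unpair.2).isSome then
      some (decide (c.unpair.2.unpair.1 ≤
        Nat.count (fun i => termVal i v c.unpair.2.unpair.2 = some true) N))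
    else none
  else none

/-- The conjunction of the values at `0, …, n - 1`, or `none` if one of them is `none`. -/
def allVal (f : ℕ → Option Bool) : ℕ → Option Bool
  | 0 => some true
  | n + 1 => Option.map₂ and (allVal f n) (f n)

/-- The truth value in the algebra of subsets of `{0, …, N - 1}` of the formula with Gödel number
`c`, or `none` if `c` is not the Gödel number of a formula in the variables that are given a
value. -/
def formulaVal (N c : ℕ) (v : List ℕ) : Option Bool :=
  let rec' (k : ℕ) (w : List ℕ) : Option Bool := if k < c then formulaVal N k w else none
  if c.unpair.1 = 3 then
    Option.map₂ (fun x y => !x || y) (rec' c.unpair.2.unpair.1 v) (rec' c.unpair.2.unpair.2 v)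
  else if c.unpair.1 = 4 then allVal (fun x => rec' c.unpair.2 (v ++ [x])) (2 ^ N)
  else atomicVal N c v

theorem lt_pair_right {a b : ℕ} (ha : a ≠ 0) : b < Nat.pair a b := by
  have := Nat.add_le_pair a b
  omega

theorem lt_pair_pair_left {a b c : ℕ} (ha : a ≠ 0) : b < Nat.pair a (Nat.pair b c) :=
  (Nat.left_le_pair b c).trans_lt (lt_pair_right ha)

theorem lt_pair_pair_right {a b c : ℕ} (ha : a ≠ 0) : c < Nat.pair a (Nat.pair b c) :=
  (Nat.right_le_pair b c).trans_lt (lt_pair_right ha)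

theorem termCode_tZero {m : ℕ} : termCode (tZero : L.Term (Empty ⊕ Fin m)) = Nat.pair 1 0 := rfl

theorem termCode_tOne {m : ℕ} : termCode (tOne : L.Term (Empty ⊕ Fin m)) = Nat.pair 2 0 := rfl

theorem termCode_tCompl {m : ℕ} (t : L.Term (Empty ⊕ Fin m)) :
    termCode (tCompl t) = Nat.pair 3 (termCode t) := rfl

theorem termCode_tInf {m : ℕ} (s t : L.Term (Empty ⊕ Fin m)) :
    termCode (tInf s t) = Nat.pair 4 (Nat.pair (termCode s) (termCode t)) := rfl

theorem termCode_tSup {m : ℕ} (s t : L.Term (Empty ⊕ Fin m)) :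
    termCode (tSup s t) = Nat.pair 5 (Nat.pair (termCode s) (termCode t)) := rfl

theorem termVal_pair_zero (i : ℕ) (v : List ℕ) (p : ℕ) :
    termVal i v (Nat.pair 0 p) = v[p]?.map fun x => x.testBit i := by
  rw [termVal]; simp

theorem termVal_pair_one (i : ℕ) (v : List ℕ) (p : ℕ) :
    termVal i v (Nat.pair 1 p) = if p = 0 then some false else none := by
  rw [termVal]; simp

theorem termVal_pair_two (i : ℕ) (v : List ℕ) (p : ℕ) :
    termVal i v (Nat.pair 2 p) = if p = 0 then some true else none := by
  rw [termVal]; simp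

theorem termVal_pair_three (i : ℕ) (v : List ℕ) (p : ℕ) :
    termVal i v (Nat.pair 3 p) = (termVal i v p).map not := by
  rw [termVal]; simp [lt_pair_right]

theorem termVal_pair_four (i : ℕ) (v : List ℕ) (p q : ℕ) :
    termVal i v (Nat.pair 4 (Nat.pair p q)) =
      Option.map₂ and (termVal i v p) (termVal i v q) := by
  rw [termVal]; simp [lt_pair_pair_left, lt_pair_pair_right]

theorem termVal_pair_five (i : ℕ) (v : List ℕ) (p q : ℕ) :
    termVal i v (Nat.pair 5 (Nat.pair p q)) =
      Option.map₂ or (termVal i v p) (termVal i v q) := by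
  rw [termVal]; simp [lt_pair_pair_left, lt_pair_pair_right]

theorem formulaVal_pair_three (N : ℕ) (v : List ℕ) (p q : ℕ) :
    formulaVal N (Nat.pair 3 (Nat.pair p q)) v =
      Option.map₂ (fun x y => !x || y) (formulaVal N p v) (formulaVal N q v) := by
  rw [formulaVal]; simp [lt_pair_pair_left, lt_pair_pair_right]

theorem formulaVal_pair_four (N : ℕ) (v : List ℕ) (p : ℕ) :
    formulaVal N (Nat.pair 4 p) v = allVal (fun x => formulaVal N p (v ++ [x])) (2 ^ N) := by
  rw [formulaVal]; simp [lt_pair_right]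

theorem formulaVal_of_ne {c : ℕ} (N : ℕ) (v : List ℕ) (h3 : c.unpair.1 ≠ 3) (h4 : c.unpair.1 ≠ 4) :
    formulaVal N c v = atomicVal N c v := by
  rw [formulaVal]; simp [h3, h4]

theorem allVal_eq_some {f : ℕ → Option Bool} {p : ℕ → Prop} [DecidablePred p] {n : ℕ}
    (h : ∀ x < n, f x = some (decide (p x))) : allVal f n = some (decide (∀ x < n, p x)) := by
  induction n with
  | zero => simp [allVal]
  | succ n ih =>
    rw [allVal, ih fun x hx => h x (by omega), h n (by omega), Option.map₂_some_some,
      Option.some_inj, ← Bool.decide_and, decide_eq_decide, Nat.forall_lt_succ_right]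

theorem isSome_of_isSome_allVal {f : ℕ → Option Bool} {n x : ℕ} (hx : x < n)
    (h : (allVal f n).isSome) : (f x).isSome := by
  induction n with
  | zero => omega
  | succ n ih =>
    rw [allVal] at h
    cases h1 : allVal f n with
    | none => simp [h1] at h
    | some b =>
      cases h2 : f n with
      | none => simp [h2] at h
      | some b' =>
        rcases (Nat.lt_succ_iff_lt_or_eq.1 hx) with h' | rfl
        · exact ih h' (by simp [h1])
        · simp [h2]

open scoped Classical in
theorem termVal_termCode {m : ℕ} (i : ℕ) (v : List ℕ) (hv : v.length = m)
    (t : L.Term (Empty ⊕ Fin m)) :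
    termVal i v (termCode t) =
      some (decide (t.realize
        (Sum.elim Empty.elim fun j : Fin m => ((v.getD j 0).testBit i : Prop)))) := by
  induction t using term_induction with
  | var j =>
    rcases j with e | j
    · exact e.elim
    · simp [termCode, termVal_pair_zero, hv]
  | zero => simp [termCode_tZero, termVal_pair_one]
  | one => simp [termCode_tOne, termVal_pair_two]
  | compl t ih => simp only [termCode_tCompl, termVal_pair_three, ih, realize_tCompl]; simp
  | inf s t hs ht => simp only [termCode_tInf, termVal_pair_four, hs, ht, realize_tInf]; simp
  | sup s t hs ht => simp only [termCode_tSup, termVal_pair_five, hs, ht, realize_tSup]; simp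

theorem exists_termCode_eq {m : ℕ} (i : ℕ) (v : List ℕ) (hv : v.length = m) (n : ℕ)
    (h : (termVal i v n).isSome) : ∃ t : L.Term (Empty ⊕ Fin m), termCode t = n := by
  induction n using Nat.strong_induction_on with
  | _ n ih =>
    obtain ⟨a, p, rfl⟩ : ∃ a p, n = Nat.pair a p := ⟨_, _, (Nat.pair_unpair n).symm⟩
    obtain ⟨q, r, hp⟩ : ∃ q r, p = Nat.pair q r := ⟨_, _, (Nat.pair_unpair p).symm⟩
    rcases lt_or_ge 5 a with ha | ha
    · rw [termVal] at h
      simp [show a ≠ 0 by omega, show a ≠ 1 by omega, show a ≠ 2 by omega, show a ≠ 3 by omega,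
        show a ≠ 4 by omega, show a ≠ 5 by omega] at h
    interval_cases a
    · rw [termVal_pair_zero] at h
      exact ⟨tVar ⟨p, by simpa [hv] using h⟩, rfl⟩
    · rw [termVal_pair_one] at h
      exact ⟨tZero, by split_ifs at h with h0 <;> simp_all [termCode_tZero]⟩
    · rw [termVal_pair_two] at h
      exact ⟨tOne, by split_ifs at h with h0 <;> simp_all [termCode_tOne]⟩
    · rw [termVal_pair_three] at h
      obtain ⟨t, ht⟩ := ih p (lt_pair_right (by simp)) (by simpa using h)
      exact ⟨tCompl t, by rw [termCode_tCompl, ht]⟩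
    · subst hp
      rw [termVal_pair_four] at h
      obtain ⟨s, hs⟩ := ih q (lt_pair_pair_left (by simp)) (by
        cases h1 : termVal i v q <;> simp_all)
      obtain ⟨t, ht⟩ := ih r (lt_pair_pair_right (by simp)) (by
        cases h1 : termVal i v r <;> simp_all)
      exact ⟨tInf s t, by rw [termCode_tInf, hs, ht]⟩
    · subst hp
      rw [termVal_pair_five] at h
      obtain ⟨s, hs⟩ := ih q (lt_pair_pair_left (by simp)) (by
        cases h1 : termVal i v q <;> simp_all)
      obtain ⟨t, ht⟩ := ih r (lt_pair_pair_right (by simp)) (by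
        cases h1 : termVal i v r <;> simp_all)
      exact ⟨tSup s t, by rw [termCode_tSup, hs, ht]⟩

/-- The set of positions below `N` of the binary digits `1` of `x`. -/
def bits (N x : ℕ) : Set (Fin N) := {i | x.testBit i}

theorem forall_bits_iff {N : ℕ} {p : Set (Fin N) → Prop} :
    (∀ s, p s) ↔ ∀ x < 2 ^ N, p (bits N x) := by
  classical
  refine ⟨fun h x _ => h _, fun h s => ?_⟩
  convert h (Nat.ofBits fun i : Fin N => decide (i ∈ s)) (Nat.ofBits_lt_two_pow _)
  ext i
  simp [bits, Nat.testBit_ofBits_lt]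

theorem mem_realize_iff {N m : ℕ} (v : List ℕ) (hv : v.length = m) (t : L.Term (Empty ⊕ Fin m))
    (e : Empty → Set (Fin N)) (i : Fin N) :
    i ∈ t.realize (Sum.elim e fun j : Fin m => bits N (v.getD j 0)) ↔
      termVal i v (termCode t) = some true := by
  classical
  rw [termVal_termCode i v hv, ← Set.singleton_subset_iff,
    isAtom_le_realize_iff (Set.isAtom_singleton i)]
  simp only [Option.some_inj, decide_eq_true_eq]
  have : (fun j => ({i} : Set (Fin N)) ≤ Sum.elim e (fun j : Fin m => bits N (v.getD j 0)) j) =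
      Sum.elim Empty.elim fun j : Fin m => ((v.getD j 0).testBit i : Prop) := by
    funext j
    rcases j with j | j
    · exact j.elim
    · simp [bits]
  rw [this]

theorem encard_isAtom_le {X : Type*} (s : Set X) :
    {a : Set X | IsAtom a ∧ a ≤ s}.encard = s.encard := by
  rw [← Set.InjOn.encard_image (f := fun x : X => ({x} : Set X))
    (Set.singleton_injective.injOn)]
  congr 1
  ext a
  simp only [Set.isAtom_iff, Set.mem_ofPred_eq, Set.mem_image]
  constructor
  · rintro ⟨⟨x, rfl⟩, h⟩
    exact ⟨x, by simpa using h, rfl⟩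
  · rintro ⟨x, hx, rfl⟩
    exact ⟨⟨x, rfl⟩, by simpa using hx⟩

theorem encard_setOf_fin (N : ℕ) (p : ℕ → Prop) [DecidablePred p] :
    {i : Fin N | p i}.encard = Nat.count p N := by
  rw [← Fin.val_injective.encard_image, Nat.count_eq_card_filter_range,
    ← Set.encard_coe_eq_coe_finsetCard]
  congr 1
  ext x
  simp only [Set.mem_image, Set.mem_ofPred_eq, Finset.coe_filter, Finset.mem_range]
  exact ⟨fun ⟨i, hi, h⟩ => h ▸ ⟨i.2, hi⟩, fun ⟨h, hp⟩ => ⟨⟨x, h⟩, hp, rfl⟩⟩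

open scoped Classical in
theorem formulaVal_formulaCode {N m : ℕ} (φ : L.BoundedFormula Empty m) (e : Empty → Set (Fin N)) :
    ∀ v : List ℕ, v.length = m → formulaVal N (formulaCode φ) v =
      some (decide (φ.Realize e fun j : Fin m => bits N (v.getD j 0))) := by
  induction φ with
  | falsum =>
    intro v hv
    rw [formulaVal_of_ne] <;> simp [formulaCode, atomicVal]
    exact fun h => h
  | equal s t =>
    intro v hv
    have hs : (termVal 0 v (termCode s)).isSome := by simp [termVal_termCode 0 v hv s]
    have ht : (termVal 0 v (termCode t)).isSome := by simp [termVal_termCode 0 v hv t]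
    rw [formulaVal_of_ne] <;> simp only [formulaCode, atomicVal, Nat.unpair_pair, ne_eq]
    · simp only [hs, ht, and_self, if_true, one_ne_zero, if_false, Option.some_inj, decide_eq_decide,
        BoundedFormula.Realize, Set.ext_iff, mem_realize_iff v hv, Fin.forall_iff]
      refine forall₂_congr fun i _ => ?_
      rw [termVal_termCode i v hv, termVal_termCode i v hv]
      simp [decide_eq_decide]
    all_goals simp
  | rel R ts =>
    intro v hv
    obtain ⟨n⟩ := R
    have ht : (termVal 0 v (termCode (ts 0))).isSome := by simp [termVal_termCode 0 v hv (ts 0)]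
    rw [formulaVal_of_ne] <;> simp only [formulaCode, atomicVal, Nat.unpair_pair, ne_eq]
    · simp only [ht, n.ne_zero, not_false_eq_true, and_self, if_true, OfNat.ofNat_ne_zero,
        OfNat.ofNat_ne_one, if_false, Option.some_inj]
      refine decide_eq_decide.2 ?_
      rw [BoundedFormula.Realize]
      rw [relMap_C, encard_isAtom_le, ← Nat.cast_le (α := ℕ∞), ← encard_setOf_fin]
      simp only [← mem_realize_iff v hv (e := e)]
      rfl
    all_goals simp
  | imp φ ψ hφ hψ =>
    intro v hv
    rw [formulaCode, formulaVal_pair_three, hφ v hv, hψ v hv]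
    simp [BoundedFormula.realize_imp, imp_iff_not_or]
  | @all m φ ih =>
    intro v hv
    rw [formulaCode, formulaVal_pair_four, allVal_eq_some fun x _ => ih (v ++ [x]) (by simp [hv])]
    rw [Option.some_inj, decide_eq_decide, BoundedFormula.realize_all, forall_bits_iff]
    refine forall₂_congr fun x _ => iff_of_eq (congrArg _ (funext fun j => ?_))
    induction j using Fin.lastCases with
    | last => simp [← hv]
    | cast j => simp [hv]

/-- The evaluator also acts as a parser: it yields a value only on genuine codes, so numbers that
code nothing are rejected. -/
theorem exists_formulaCode_eq (N c : ℕ) : ∀ (v : List ℕ) (m : ℕ), v.length = m →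
    (formulaVal N c v).isSome → ∃ φ : L.BoundedFormula Empty m, formulaCode φ = c := by
  induction c using Nat.strong_induction_on with
  | _ c ih =>
    intro v m hv h
    obtain ⟨a, p, rfl⟩ : ∃ a p, c = Nat.pair a p := ⟨_, _, (Nat.pair_unpair c).symm⟩
    obtain ⟨q, r, hp⟩ : ∃ q r, p = Nat.pair q r := ⟨_, _, (Nat.pair_unpair p).symm⟩
    rcases lt_or_ge 4 a with ha | ha
    · rw [formulaVal_of_ne _ _ (by simp; omega) (by simp; omega), atomicVal] at h
      simp [show a ≠ 0 by omega, show a ≠ 1 by omega, show a ≠ 2 by omega] at h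
    interval_cases a
    · rw [formulaVal_of_ne _ _ (by simp) (by simp), atomicVal] at h
      refine ⟨.falsum, ?_⟩
      simp only [Nat.unpair_pair, if_true] at h
      split_ifs at h with h0 <;> simp_all [formulaCode]
    · subst hp
      rw [formulaVal_of_ne _ _ (by simp) (by simp), atomicVal] at h
      simp only [Nat.unpair_pair, one_ne_zero, if_true, if_false] at h
      split_ifs at h with h0
      · obtain ⟨s, hs⟩ := exists_termCode_eq 0 v hv q h0.1
        obtain ⟨t, ht⟩ := exists_termCode_eq 0 v hv r h0.2
        exact ⟨.equal s t, by rw [formulaCode, hs, ht]⟩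
      · simp at h
    · subst hp
      rw [formulaVal_of_ne _ _ (by simp) (by simp), atomicVal] at h
      simp only [Nat.unpair_pair, OfNat.ofNat_ne_zero, OfNat.ofNat_ne_one, if_true, if_false] at h
      split_ifs at h with h0
      · obtain ⟨t, ht⟩ := exists_termCode_eq 0 v hv r h0.2
        exact ⟨.rel (Rel.C ⟨q, Nat.pos_of_ne_zero h0.1⟩) ![t], by simp [formulaCode, ht]⟩
      · simp at h
    · subst hp
      rw [formulaVal_pair_three] at h
      obtain ⟨φ, hφ⟩ := ih q (lt_pair_pair_left (by simp)) v m hv (by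
        cases h1 : formulaVal N q v <;> simp_all)
      obtain ⟨ψ, hψ⟩ := ih r (lt_pair_pair_right (by simp)) v m hv (by
        cases h1 : formulaVal N r v <;> simp_all)
      exact ⟨.imp φ ψ, by rw [formulaCode, hφ, hψ]⟩
    · rw [formulaVal_pair_four] at h
      -- Since `0 < 2 ^ N`, the conjunction is not empty, and the instance `x = 0` already certifies
      -- that the body is well formed.
      obtain ⟨φ, hφ⟩ := ih p (lt_pair_right (by simp)) (v ++ [0]) (m + 1) (by simp [hv])
        (isSome_of_isSome_allVal (f := fun x => formulaVal N p (v ++ [x])) (Nat.two_pow_pos N) h)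
      exact ⟨.all φ, by rw [formulaCode, hφ]⟩

/-- A quantifier doubles the weight but also increases the code by at least 1. -/
theorem weight_le_two_pow_formulaCode {m : ℕ} (φ : L.BoundedFormula Empty m) :
    weight φ ≤ 2 ^ formulaCode φ := by
  induction φ with
  | falsum => simp [weight]
  | equal s t => exact Nat.one_le_two_pow
  | rel R ts =>
    obtain ⟨n⟩ := R
    exact (lt_pair_pair_left (by simp)).le.trans Nat.lt_two_pow_self.le
  | imp φ ψ hφ hψ =>
    refine max_le (hφ.trans ?_) (hψ.trans ?_)
    · exact Nat.pow_le_pow_right (by simp) (lt_pair_pair_left (by simp)).le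
    · exact Nat.pow_le_pow_right (by simp) (lt_pair_pair_right (by simp)).le
  | all φ ih =>
    rw [weight]
    refine (Nat.mul_le_mul_left 2 ih).trans ?_
    rw [← pow_succ']
    exact Nat.pow_le_pow_right (by simp) (lt_pair_right (by simp))

/-- A number is the Gödel number of a consequence of the theory iff it evaluates to true in the
algebra of subsets of a sufficiently large finite set. -/
theorem exists_models_iff_formulaVal (c : ℕ) :
    (∃ φ : L.Sentence, formulaCode φ = c ∧ theoryInfAtomic.{u} ⊨ᵇ φ) ↔
      formulaVal (2 ^ c) c [] = some true := by
  classical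
  have key (φ : L.Sentence) : theoryInfAtomic.{u} ⊨ᵇ φ ↔
      formulaVal (2 ^ formulaCode φ) (formulaCode φ) [] = some true := by
    rw [theoryInfAtomic_models_iff, formulaVal_formulaCode φ default [] rfl, Option.some_inj,
      decide_eq_true_eq, realize_sentence_iff_of_le_encard (B' := Set (Fin (2 ^ formulaCode φ))) φ
        (by simp [encard_isAtom])]
    · exact iff_of_eq (congrArg₂ (BoundedFormula.Realize φ) (Subsingleton.elim _ _)
        (Subsingleton.elim _ _))
    · have := encard_isAtom_le (Set.univ : Set (Fin (2 ^ formulaCode φ)))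
      simp only [Set.subset_univ, and_true] at this
      rw [this, Set.encard_univ]
      simpa using (by exact_mod_cast weight_le_two_pow_formulaCode φ :
        (weight φ : ℕ∞) ≤ (2 ^ formulaCode φ : ℕ))
  constructor
  · rintro ⟨φ, rfl, h⟩
    exact (key φ).1 h
  · intro h
    -- The empty list of values means no free variables, so `c` is the code of a sentence.
    obtain ⟨φ, rfl⟩ := exists_formulaCode_eq _ c [] 0 rfl (by rw [h]; rfl)
    exact ⟨φ, rfl, (key φ).2 h⟩

end FiniteEvaluation

end BoolAtoms

namespace BoolAtoms

/-! ### Computability of the evaluation -/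

section Computability

theorem primrec_two_pow : Primrec fun n : ℕ => 2 ^ n :=
  (Primrec₂.unpaired'.1 Nat.Primrec.pow).comp (Primrec.const 2) Primrec.id

theorem primrec_testBit : Primrec₂ Nat.testBit := by
  have : PrimrecPred fun p : ℕ × ℕ => p.1 / 2 ^ p.2 % 2 = 1 :=
    Primrec.eq.comp (Primrec.nat_mod.comp
      (Primrec.nat_div.comp Primrec.fst (primrec_two_pow.comp Primrec.snd)) (Primrec.const 2))
      (Primrec.const 1)
  exact this.decide.of_eq fun p => Nat.testBit_eq_decide_div_mod_eq.symm

theorem primrec_map₂ {α : Type*} [Primcodable α] (g : Bool → Bool → Bool) {f₁ f₂ : α → Option Bool}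
    (h₁ : Primrec f₁) (h₂ : Primrec f₂) : Primrec fun a => Option.map₂ g (f₁ a) (f₂ a) :=
  (Primrec.dom_finite fun p : Option Bool × Option Bool => Option.map₂ g p.1 p.2).comp (h₁.pair h₂)

theorem primrec_unpair_fst {α : Type*} [Primcodable α] {f : α → ℕ} (h : Primrec f) :
    Primrec fun a => (f a).unpair.1 :=
  Primrec.fst.comp (Primrec.unpair.comp h)

theorem primrec_unpair_snd {α : Type*} [Primcodable α] {f : α → ℕ} (h : Primrec f) :
    Primrec fun a => (f a).unpair.2 :=
  Primrec.snd.comp (Primrec.unpair.comp h)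

theorem primrec_termVal : Primrec₂ fun (p : ℕ × List ℕ) (n : ℕ) => termVal p.1 p.2 n := by
  -- Course-of-values recursion: `l` lists the values at all smaller codes, so its length is the
  -- current code, and the default `none` reproduces the guard in `termVal`.
  let g (p : ℕ × List ℕ) (l : List (Option Bool)) : Option Bool :=
    if l.length.unpair.1 = 0 then p.2[l.length.unpair.2]?.map fun x => x.testBit p.1
    else if l.length.unpair.1 = 1 then if l.length.unpair.2 = 0 then some false else none
    else if l.length.unpair.1 = 2 then if l.length.unpair.2 = 0 then some true else none
    else if l.length.unpair.1 = 3 then (l.getD l.length.unpair.2 none).map not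
    else if l.length.unpair.1 = 4 then
      Option.map₂ and (l.getD l.length.unpair.2.unpair.1 none)
        (l.getD l.length.unpair.2.unpair.2 none)
    else if l.length.unpair.1 = 5 then
      Option.map₂ or (l.getD l.length.unpair.2.unpair.1 none)
        (l.getD l.length.unpair.2.unpair.2 none)
    else none
  have hg : Primrec₂ g := by
    have hl : Primrec fun p : (ℕ × List ℕ) × List (Option Bool) => p.2.length :=
      Primrec.list_length.comp Primrec.snd
    have tag (k : ℕ) : PrimrecPred fun p : (ℕ × List ℕ) × List (Option Bool) =>
        p.2.length.unpair.1 = k := Primrec.eq.comp (primrec_unpair_fst hl) (Primrec.const k)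
    have harg := primrec_unpair_snd hl
    have harg0 : PrimrecPred fun p : (ℕ × List ℕ) × List (Option Bool) =>
        p.2.length.unpair.2 = 0 := Primrec.eq.comp harg (Primrec.const 0)
    have hrec {f : (ℕ × List ℕ) × List (Option Bool) → ℕ} (hf : Primrec f) :
        Primrec fun p : (ℕ × List ℕ) × List (Option Bool) => p.2.getD (f p) none :=
      (Primrec.list_getD none).comp Primrec.snd hf
    refine .ite (tag 0) ?_ <| .ite (tag 1) (.ite harg0 (.const _) (.const _)) <|
      .ite (tag 2) (.ite harg0 (.const _) (.const _)) <|
      .ite (tag 3) ((Primrec.dom_finite (Option.map not)).comp (hrec harg)) <|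
      .ite (tag 4) (primrec_map₂ _ (hrec (primrec_unpair_fst harg))
        (hrec (primrec_unpair_snd harg))) <|
      .ite (tag 5) (primrec_map₂ _ (hrec (primrec_unpair_fst harg))
        (hrec (primrec_unpair_snd harg))) <| .const _
    exact Primrec.option_map
      (Primrec.list_getElem?.comp (Primrec.snd.comp Primrec.fst) harg)
      (primrec_testBit.comp Primrec.snd (Primrec.fst.comp (Primrec.fst.comp Primrec.fst)))
  refine Primrec.nat_strong_rec _ (g := fun p l => some (g p l)) (Primrec.option_some.comp hg) ?_
  rintro ⟨i, v⟩ n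
  have hget (k : ℕ) : ((List.range n).map (termVal i v)).getD k none =
      if k < n then termVal i v k else none := by
    split_ifs with h
    · simp [h]
    · simp [not_lt.1 h]
  simp only [g, List.length_map, List.length_range, hget, Option.some_inj]
  conv_rhs => rw [termVal]

theorem primrec_count {α : Type*} [Primcodable α] {p : ℕ → α → Prop} [∀ a, DecidablePred (p · a)]
    (hp : PrimrecRel p) {f : α → ℕ} (hf : Primrec f) : Primrec fun a => Nat.count (p · a) (f a) := by
  have h : Primrec fun a : α => Nat.rec (motive := fun _ => ℕ) 0
      (fun i k => k + if p i a then 1 else 0) (f a) := by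
    have hite : Primrec fun x : α × (ℕ × ℕ) => if p x.2.1 x.1 then 1 else 0 :=
      Primrec.ite (hp.comp (Primrec.fst.comp Primrec.snd) Primrec.fst) (.const _) (.const _)
    exact Primrec.nat_rec' hf (Primrec.const 0)
      (Primrec.nat_add.comp (Primrec.snd.comp Primrec.snd) hite).to₂
  refine h.of_eq fun a => ?_
  generalize f a = n
  induction n with
  | zero => simp
  | succ n ih => simp only [Nat.count_succ, ih]

theorem primrec_atomicVal : Primrec fun x : ℕ × ℕ × List ℕ => atomicVal x.1 x.2.1 x.2.2 := by
  have hc : Primrec fun x : ℕ × ℕ × List ℕ => x.2.1 := Primrec.fst.comp Primrec.snd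
  have hv : Primrec fun x : ℕ × ℕ × List ℕ => x.2.2 := Primrec.snd.comp Primrec.snd
  have tag (k : ℕ) : PrimrecPred fun x : ℕ × ℕ × List ℕ => x.2.1.unpair.1 = k :=
    Primrec.eq.comp (primrec_unpair_fst hc) (Primrec.const k)
  have harg := primrec_unpair_snd hc
  have hval {α : Type} [Primcodable α] {i n : α → ℕ} {v : α → List ℕ} (hi : Primrec i)
      (hn : Primrec n) (hv : Primrec v) : Primrec fun a => termVal (i a) (v a) (n a) :=
    primrec_termVal.comp (hi.pair hv) hn
  have hwf {n : ℕ × ℕ × List ℕ → ℕ} (hn : Primrec n) : PrimrecPred fun x =>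
      ((termVal 0 x.2.2 (n x)).isSome : Prop) :=
    Primrec.eq.comp (Primrec.option_isSome.comp (hval (Primrec.const 0) hn hv)) (Primrec.const true)
  have hleft := primrec_unpair_fst harg
  have hright := primrec_unpair_snd harg
  refine .ite (tag 0) (.ite (Primrec.eq.comp harg (.const 0)) (.const _) (.const _)) <|
    .ite (tag 1) (.ite ((hwf hleft).and (hwf hright)) (Primrec.option_some.comp ?_) (.const _)) <|
    .ite (tag 2) (.ite ((Primrec.eq.comp hleft (.const 0)).not.and (hwf hright))
      (Primrec.option_some.comp ?_) (.const _)) (.const _)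
  · have : PrimrecRel fun (i : ℕ) (x : ℕ × ℕ × List ℕ) =>
        termVal i x.2.2 x.2.1.unpair.2.unpair.1 = termVal i x.2.2 x.2.1.unpair.2.unpair.2 :=
      Primrec.eq.comp (hval Primrec.fst (hleft.comp Primrec.snd) (hv.comp Primrec.snd))
        (hval Primrec.fst (hright.comp Primrec.snd) (hv.comp Primrec.snd))
    have hall : PrimrecPred fun x : ℕ × ℕ × List ℕ => ∀ i < x.1,
        termVal i x.2.2 x.2.1.unpair.2.unpair.1 = termVal i x.2.2 x.2.1.unpair.2.unpair.2 :=
      (this.forall_mem_list.comp (Primrec.list_range.comp Primrec.fst) Primrec.id).of_eq (by simp)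
    exact hall.decide
  · have : PrimrecRel fun (i : ℕ) (x : ℕ × ℕ × List ℕ) =>
        termVal i x.2.2 x.2.1.unpair.2.unpair.2 = some true :=
      Primrec.eq.comp (hval Primrec.fst (hright.comp Primrec.snd) (hv.comp Primrec.snd))
        (Primrec.const _)
    exact (Primrec.nat_le.comp hleft (primrec_count this Primrec.fst)).decide

open Nat.Partrec (Code)
open Encodable Denumerable

/-- The result of a program for the evaluation of formulas. -/
def runVal (e : Code) (x : ℕ × ℕ × List ℕ) : Part (Option Bool) :=
  (e.eval (encode x)).map fun r => (decode (α := Option Bool) r).getD none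

/-- One step of the recursive evaluation of formulas, where `e` is a program for the recursive
calls. -/
def evalStep (e : Code) (x : ℕ × ℕ × List ℕ) : Part (Option Bool) :=
  bif decide (x.2.1.unpair.1 = 3) then
    (runVal e (x.1, x.2.1.unpair.2.unpair.1, x.2.2)).bind fun a =>
      (runVal e (x.1, x.2.1.unpair.2.unpair.2, x.2.2)).map fun b =>
        Option.map₂ (fun a b => !a || b) a b
  else bif decide (x.2.1.unpair.1 = 4) then
    -- This loop mirrors `allVal`, with the recursive calls made through the program `e`.
    Nat.rec (Part.some (some true)) (fun y acc => acc.bind fun a =>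
      (runVal e (x.1, x.2.1.unpair.2, x.2.2 ++ [y])).map fun b => Option.map₂ and a b) (2 ^ x.1)
  else Part.some (atomicVal x.1 x.2.1 x.2.2)

theorem partrec_runVal : Partrec₂ runVal := by
  refine Partrec.map (Nat.Partrec.Code.eval_part.comp Computable.fst
    (Computable.encode.comp Computable.snd)) ?_
  exact (Computable.option_getD (Computable.decode.comp Computable.snd) (Computable.const none)).to₂

theorem partrec_evalStep : Partrec₂ evalStep := by
  have hx : Computable fun p : Code × (ℕ × ℕ × List ℕ) => p.2 := Computable.snd
  have hN := Computable.fst.comp hx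
  have hc := Computable.fst.comp (Computable.snd.comp hx)
  have hv := Computable.snd.comp (Computable.snd.comp hx)
  have hunpair {α : Type} [Primcodable α] {f : α → ℕ} (hf : Computable f) :=
    Computable.unpair.comp hf
  have harg := Computable.snd.comp (hunpair hc)
  have hmap₂ (g : Bool → Bool → Bool) {α : Type} [Primcodable α] {f₁ f₂ : α → Option Bool}
      (h₁ : Computable f₁) (h₂ : Computable f₂) :
      Computable fun a => Option.map₂ g (f₁ a) (f₂ a) :=
    (Primrec.dom_finite fun p : Option Bool × Option Bool =>
      Option.map₂ g p.1 p.2).to_comp.comp (h₁.pair h₂)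
  have htag (k : ℕ) : Computable fun p : Code × (ℕ × ℕ × List ℕ) =>
      decide (p.2.2.1.unpair.1 = k) :=
    (Primrec.eq.decide.to_comp.comp (Computable.fst.comp (hunpair hc)) (Computable.const k))
  refine Partrec.cond (htag 3) ?_ (Partrec.cond (htag 4) ?_ ?_)
  · refine Partrec.bind (partrec_runVal.comp Computable.fst
      (hN.pair ((Computable.fst.comp (hunpair harg)).pair hv))) ?_
    refine Partrec.map ((partrec_runVal.comp Computable.fst
      (hN.pair ((Computable.snd.comp (hunpair harg)).pair hv))).comp Computable.fst) ?_
    exact (hmap₂ _ (Computable.snd.comp Computable.fst) Computable.snd).to₂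
  · have hfst : Computable fun q : (Code × (ℕ × ℕ × List ℕ)) × (ℕ × Option Bool) => q.1 :=
      Computable.fst
    have hy : Computable fun q : (Code × (ℕ × ℕ × List ℕ)) × (ℕ × Option Bool) => q.2.1 :=
      Computable.fst.comp Computable.snd
    have hbody : Partrec₂ fun (p : Code × (ℕ × ℕ × List ℕ)) (q : ℕ × Option Bool) =>
        (runVal p.1 (p.2.1, p.2.2.1.unpair.2, p.2.2.2 ++ [q.1])).map fun b =>
          Option.map₂ and q.2 b :=
      Partrec.map (partrec_runVal.comp (Computable.fst.comp hfst) ((hN.comp hfst).pair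
        ((harg.comp hfst).pair (Computable.list_concat.comp (hv.comp hfst) hy))))
        (hmap₂ _ (Computable.snd.comp (Computable.snd.comp Computable.fst)) Computable.snd).to₂
    have hpow : Computable fun p : Code × (ℕ × ℕ × List ℕ) => 2 ^ p.2.1 :=
      primrec_two_pow.to_comp.comp hN
    have hzero : Partrec fun _ : Code × (ℕ × ℕ × List ℕ) =>
        (Part.some (some true) : Part (Option Bool)) := (Computable.const (some true)).partrec
    have hloop := Partrec.nat_rec hpow hzero hbody
    exact hloop
  · exact (primrec_atomicVal.to_comp.comp hx).partrec

theorem evalStep_eq {e : Code} {N c : ℕ} (v : List ℕ)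
    (h : ∀ k < c, ∀ w, runVal e (N, k, w) = Part.some (formulaVal N k w)) :
    evalStep e (N, c, v) = Part.some (formulaVal N c v) := by
  obtain ⟨a, p, rfl⟩ : ∃ a p, c = Nat.pair a p := ⟨_, _, (Nat.pair_unpair c).symm⟩
  simp only [evalStep, Nat.unpair_pair]
  by_cases h3 : a = 3
  · subst h3
    obtain ⟨q, r, rfl⟩ : ∃ q r, p = Nat.pair q r := ⟨_, _, (Nat.pair_unpair p).symm⟩
    simp [h _ (lt_pair_pair_left _), h _ (lt_pair_pair_right _), formulaVal_pair_three]
  by_cases h4 : a = 4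
  · subst h4
    simp only [h p (lt_pair_right (by simp)), Part.map_some, formulaVal_pair_four]
    generalize 2 ^ N = n
    simp only [Nat.reduceEqDiff, decide_false, decide_true, cond_false,
      cond_true]
    induction n with
    | zero => rfl
    | succ n ih => simp [ih, allVal]
  · simp [h3, h4, formulaVal_of_ne]

/-- Recursive calls under a quantifier change the list of values, so plain course-of-values
recursion on the code with fixed parameters does not apply. Kleene's second recursion theorem
supplies instead a program that may call itself; induction on the code, for all lists at once, shows
that it halts with the right value. -/
theorem computable_formulaVal :
    Computable fun x : ℕ × ℕ × List ℕ => formulaVal x.1 x.2.1 x.2.2 := by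
  have hf : Partrec₂ fun (e : Code) (n : ℕ) =>
      (evalStep e (ofNat (ℕ × ℕ × List ℕ) n)).map encode :=
    Partrec.map (partrec_evalStep.comp Computable.fst ((Computable.ofNat _).comp Computable.snd))
      (Computable.encode.comp Computable.snd).to₂
  obtain ⟨e, he⟩ := Nat.Partrec.Code.fixed_point₂ hf
  have hrun (x : ℕ × ℕ × List ℕ) : runVal e x = evalStep e x := by
    simp only [runVal, he, ofNat_encode, Part.map_map]
    simp [Function.comp_def, Part.map_id']
  have hval (N c : ℕ) : ∀ v, runVal e (N, c, v) = Part.some (formulaVal N c v) := by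
    induction c using Nat.strong_induction_on with
    | _ c ih => exact fun v => (hrun _).trans (evalStep_eq v ih)
  refine Partrec.of_eq_tot (f := runVal e)
    (partrec_runVal.comp (Computable.const e) Computable.id) fun x => ?_
  rw [hval]
  exact Part.mem_some _

theorem isDecidable_theoryInfAtomic : IsDecidable theoryInfAtomic.{u} := by
  have h : Computable fun c : ℕ => decide (formulaVal (2 ^ c) c [] = some true) :=
    Primrec.eq.decide.to_comp.comp (computable_formulaVal.comp
      (primrec_two_pow.to_comp.pair (Computable.id.pair (Computable.const []))))
      (Computable.const _)
  refine ComputablePred.computable_iff.2 ⟨_, h, ?_⟩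
  funext c
  rw [exists_models_iff_formulaVal]
  simp

end Computability

end BoolAtoms

theorem theorem1 :
    BoolAtoms.theoryInfAtomic.{u}.IsComplete ∧
    BoolAtoms.IsDecidable BoolAtoms.theoryInfAtomic.{u} ∧
    BoolAtoms.HasQuantifierElimination BoolAtoms.theoryInfAtomic.{u} ∧
    BoolAtoms.IsAxiomatizedBy BoolAtoms.theoryInfAtomic.{u} BoolAtoms.axiomsInfAtomic ∧
    (∀ (M : Type u) (S : BoolAtoms.L.Structure M),
      M ⊨ BoolAtoms.axiomsInfAtomic ↔
        Infinite M ∧ ∃ _ : BooleanAlgebra M, IsAtomic M ∧ S = BoolAtoms.structureOf M) :=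
  ⟨BoolAtoms.isComplete_theoryInfAtomic, BoolAtoms.isDecidable_theoryInfAtomic,
    BoolAtoms.hasQuantifierElimination_theoryInfAtomic,
    BoolAtoms.isAxiomatizedBy_axiomsInfAtomic, fun _ => BoolAtoms.model_axiomsInfAtomic_iff⟩
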